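/- Let $\Bbbk$ be a commutative ring and $k\in\mathbb Z$. All composites of morphisms are written $b\circ a$ ($a$ first), and $\mathbf 1$ is the unit object. **The Heisenberg category.** $\mathcal{H}eis_k$ is the strict $\Bbbk$-linear monoidal category generated by objects $\uparrow,\downarrow$ and morphisms $x:\uparrow\to\uparrow$, $s:\uparrow\otimes\uparrow\to\uparrow\otimes\uparrow$, $c:\mathbf 1\to\downarrow\otimes\uparrow$, $d:\uparrow\otimes\downarrow\to\mathbf 1$ subject to * $s^2=1$, $(s\otimes 1)(1\otimes s)(s\otimes 1)=(1\otimes s)(s\otimes 1)(1\otimes s)$, $(x\otimes 1)\circ s-s\circ(1\otimes x)=1$; * $(d\otimes 1_\uparrow)\circ(1_\uparrow\otimes c)=1_\uparrow$ and $(1_\downarrow\otimes d)\circ(c\otimes 1_\downarrow)=1_\downarrow$; * the inversion relation: with $t:=(1_\downarrow\otimes 1_\uparrow\otimes d)\circ(1_\downarrow\otimes s\otimes 1_\downarrow)\circ(c\otimes 1_\uparrow\otimes 1_\downarrow):\uparrow\otimes\downarrow\to\downarrow\otimes\uparrow$, a two-sided inverse is adjoined (in the additive envelope) to the matrix $$\bigl[\,t,\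 d,\ d\circ(x\otimes 1),\ \dots,\ d\circ(x^{k-1}\otimes 1)\,\bigr]^T:\uparrow\otimes\downarrow\to\downarrow\otimes\uparrow\oplus\mathbf 1^{\oplus k}\quad(k\ge 0),$$ $$\bigl[\,t,\ c,\ (1\otimes x)\circ c,\ \dots,\ (1\otimes x^{-k-1})\circ c\,\bigr]:\uparrow\otimes\downarrow\oplus\mathbf 1^{\oplus(-k)}\to\downarrow\otimes\uparrow\quad(k<0).$$ The inverse matrix is written $[t',c_0,\dots,c_{k-1}]$ if $k\ge0$ and $[t',d_0,\dots,d_{-k-1}]^T$ if $k<0$, where $t':\downarrow\otimes\uparrow\to\uparrow\otimes\downarrow$, $c_r:\mathbf 1\to\uparrow\otimes\downarrow$, $d_r:\downarrow\otimes\uparrow\to\mathbf 1$. Put $$x':=(1_\downarrow\otimes d)\circ(1_\downarrow\otimes x\otimes 1_\downarrow)\circ(c\otimes 1_\downarrow):\downarrow\to\downarrow,$$ $$c':=\begin{cases}-c_{k-1}&k>0\\ t'\circ(1_\downarrow\otimes x^{-k})\circ c&k\le0\end{cases}\qquad d':=\begin{cases}d\circ(x^{k}\otimes 1_\downarrow)\circ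 t'&k\ge 0\\ d_{-k-1}&k<0.\end{cases}$$ **Bubbles.** For $n\ge0$ the counterclockwise and clockwise bubbles of degree $n$ are the endomorphisms $\circlearrowleft_n:=d'\circ(1_\downarrow\otimes x^n)\circ c$ and $\circlearrowright_n:=d\circ(x^n\otimes 1_\downarrow)\circ c'$ of $\mathbf 1$. In negative degrees they are defined by $$\circlearrowleft_{r-k-1}:=\det\bigl(\circlearrowright_{i-j+k}\bigr)_{i,j=1}^r\ (r\le k),\qquad \circlearrowright_{r+k-1}:=-\det\bigl(-\circlearrowleft_{i-j-k}\bigr)_{i,j=1}^r\ (r\le -k),$$ where the determinants are read as $1$ if $r=0$ and as $0$ if $r<0$. **Left tensor ideals.** A $\Bbbk$-linear left tensor ideal $\mathcal I$ consists of $\Bbbk$-submodules $\mathcal I(X,Y)\subseteq\operatorname{Hom}(X,Y)$, for all objects $X,Y$, closed under composition on both sides with arbitrary morphisms and such that $g\otimes f$ is in $\mathcal I$ whenever $f$ is, for every morphism $g$. The left tensor ideal generated by a set of morphisms is the smallest one containing it. **Lemma.** Let $f(u),f'(u)\in\Bbbk[u]$ be monic polynomials of degrees $\ell,\ell'\ge0$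 ($f'$ is not the derivative of $f$), let $k:=\ell'-\ell$, and define $\delta_r,\delta'_r\in\Bbbk$ by $$\sum_{r\ge0}\delta_ru^{-r}=u^{-k}f'(u)/f(u),\qquad \sum_{r\ge0}\delta'_ru^{-r}=-u^{k}f(u)/f'(u)\qquad\text{in }\Bbbk[[u^{-1}]].$$ Let $\mathcal I_{f,f'}$ be the $\Bbbk$-linear left tensor ideal of $\mathcal{H}eis_k$ generated by $f(x):\uparrow\to\uparrow$ and $\circlearrowleft_{r-k-1}-\delta_r1_{\mathbf 1}$ for $r=1,\dots,\ell'$. Then: 1. $\mathcal I_{f,f'}$ is equal to the $\Bbbk$-linear left tensor ideal of $\mathcal{H}eis_k$ generated by $f'(x'):\downarrow\to\downarrow$ and $\circlearrowright_{r+k-1}-\delta'_r1_{\mathbf 1}$ for $r=1,\dots,\ell$; 2. $\mathcal I_{f,f'}$ contains $\circlearrowleft_{r-k-1}-\delta_r1_{\mathbf 1}$ and $\circlearrowright_{r+k-1}-\delta'_r1_{\mathbf 1}$ for all $r\ge0$. -/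

import Mathlib

open CategoryTheory MonoidalCategory Polynomial

universe u

/-! ### Strict `k`-linear monoidal categories given by generators and relations -/

namespace StrictPresentation

section Terms

variable (k : Type u) {α : Type} (G : List α → List α → Type)

/-- Formal `k`-linear combinations of vertical composites and horizontal tensor products of
generating morphisms. Objects are words in the generating objects `α`, the tensor product of
objects is concatenation, and the unit object is the empty word. The composition is written in
diagrammatic order: `comp f g` is `f` followed by `g`. -/
inductive Term : List α → List α → Type u
  | gen {a b : List α} (g : G a b) : Term a b
  | id (a : List α) : Term a a
  | comp {a b c : List α} (f : Term a b) (g : Term b c) : Term a c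
  | tensor {a b c d : List α} (f : Term a b) (g : Term c d) : Term (a ++ c) (b ++ d)
  | zero (a b : List α) : Term a b
  | add {a b : List α} (f g : Term a b) : Term a b
  | smul {a b : List α} (r : k) (f : Term a b) : Term a b

variable {k G}

/-- Transport of a formal morphism along equalities of words. -/
def Term.cast {a b a' b' : List α} (ha : a = a') (hb : b = b') (f : Term k G a b) :
    Term k G a' b' :=
  ha ▸ hb ▸ f

/-- The `n`-fold vertical composite of a formal endomorphism. -/
def Term.pow {a : List α} (f : Term k G a a) : ℕ → Term k G a a
  | 0 => Term.id a
  | n + 1 => Term.comp (Term.pow f n) f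

/-- Formal finite sum of formal morphisms. -/
def Term.sum {a b : List α} {n : ℕ} (f : Fin n → Term k G a b) : Term k G a b :=
  (List.ofFn f).foldr Term.add (Term.zero a b)

end Terms

section Congruence

variable {k : Type u} [CommRing k] {α : Type} {G : List α → List α → Type}

/-- The smallest congruence on formal morphisms which contains the relations `R` and makes the
quotient into a strict `k`-linear monoidal category. -/
inductive Rel (R : ∀ ⦃a b : List α⦄, Term k G a b → Term k G a b → Prop) :
    ∀ {a b : List α}, Term k G a b → Term k G a b → Prop
  | of {a b : List α} {f g : Term k G a b} : R f g → Rel R f g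
  -- equivalence relation
  | refl {a b : List α} (f : Term k G a b) : Rel R f f
  | symm {a b : List α} {f g : Term k G a b} : Rel R f g → Rel R g f
  | trans {a b : List α} {f g h : Term k G a b} : Rel R f g → Rel R g h → Rel R f h
  -- compatibility with all operations
  | comp_congr {a b c : List α} {f f' : Term k G a b} {g g' : Term k G b c} :
      Rel R f f' → Rel R g g' → Rel R (f.comp g) (f'.comp g')
  | tensor_congr {a b c d : List α} {f f' : Term k G a b} {g g' : Term k G c d} :
      Rel R f f' → Rel R g g' → Rel R (f.tensor g) (f'.tensor g')
  | add_congr {a b : List α} {f f' g g' : Term k G a b} :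
      Rel R f f' → Rel R g g' → Rel R (f.add g) (f'.add g')
  | smul_congr {a b : List α} (r : k) {f f' : Term k G a b} :
      Rel R f f' → Rel R (f.smul r) (f'.smul r)
  -- category
  | id_comp {a b : List α} (f : Term k G a b) : Rel R ((Term.id a).comp f) f
  | comp_id {a b : List α} (f : Term k G a b) : Rel R (f.comp (Term.id b)) f
  | comp_assoc {a b c d : List α} (f : Term k G a b) (g : Term k G b c) (h : Term k G c d) :
      Rel R ((f.comp g).comp h) (f.comp (g.comp h))
  -- the tensor product is a strictly associative and strictly unital bifunctor
  | id_tensor_id (a b : List α) : Rel R ((Term.id a).tensor (Term.id b)) (Term.id (a ++ b))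
  | tensor_comp_tensor {a b c a' b' c' : List α} (f : Term k G a b) (g : Term k G b c)
      (f' : Term k G a' b') (g' : Term k G b' c') :
      Rel R ((f.tensor f').comp (g.tensor g')) ((f.comp g).tensor (f'.comp g'))
  | id_nil_tensor {a b : List α} (f : Term k G a b) : Rel R ((Term.id []).tensor f) f
  | tensor_id_nil {a b : List α} (f : Term k G a b) :
      Rel R ((f.tensor (Term.id [])).cast (List.append_nil a) (List.append_nil b)) f
  | tensor_assoc {a b a' b' a'' b'' : List α} (f : Term k G a b) (g : Term k G a' b')
      (h : Term k G a'' b'') :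
      Rel R (((f.tensor g).tensor h).cast (List.append_assoc a a' a'')
        (List.append_assoc b b' b'')) (f.tensor (g.tensor h))
  -- morphism spaces are `k`-modules
  | add_assoc {a b : List α} (f g h : Term k G a b) :
      Rel R ((f.add g).add h) (f.add (g.add h))
  | add_comm {a b : List α} (f g : Term k G a b) : Rel R (f.add g) (g.add f)
  | zero_add {a b : List α} (f : Term k G a b) : Rel R ((Term.zero a b).add f) f
  | one_smul {a b : List α} (f : Term k G a b) : Rel R (f.smul 1) f
  | mul_smul {a b : List α} (r s : k) (f : Term k G a b) :
      Rel R (f.smul (r * s)) ((f.smul s).smul r)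
  | smul_add {a b : List α} (r : k) (f g : Term k G a b) :
      Rel R ((f.add g).smul r) ((f.smul r).add (g.smul r))
  | add_smul {a b : List α} (r s : k) (f : Term k G a b) :
      Rel R (f.smul (r + s)) ((f.smul r).add (f.smul s))
  | zero_smul {a b : List α} (f : Term k G a b) : Rel R (f.smul 0) (Term.zero a b)
  -- composition and tensor product of morphisms are `k`-bilinear
  | add_comp {a b c : List α} (f f' : Term k G a b) (g : Term k G b c) :
      Rel R ((f.add f').comp g) ((f.comp g).add (f'.comp g))
  | comp_add {a b c : List α} (f : Term k G a b) (g g' : Term k G b c) :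
      Rel R (f.comp (g.add g')) ((f.comp g).add (f.comp g'))
  | smul_comp {a b c : List α} (r : k) (f : Term k G a b) (g : Term k G b c) :
      Rel R ((f.smul r).comp g) ((f.comp g).smul r)
  | comp_smul {a b c : List α} (r : k) (f : Term k G a b) (g : Term k G b c) :
      Rel R (f.comp (g.smul r)) ((f.comp g).smul r)
  | add_tensor {a b c d : List α} (f f' : Term k G a b) (g : Term k G c d) :
      Rel R ((f.add f').tensor g) ((f.tensor g).add (f'.tensor g))
  | tensor_add {a b c d : List α} (f : Term k G a b) (g g' : Term k G c d) :
      Rel R (f.tensor (g.add g')) ((f.tensor g).add (f.tensor g'))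
  | smul_tensor {a b c d : List α} (r : k) (f : Term k G a b) (g : Term k G c d) :
      Rel R ((f.smul r).tensor g) ((f.tensor g).smul r)
  | tensor_smul {a b c d : List α} (r : k) (f : Term k G a b) (g : Term k G c d) :
      Rel R (f.tensor (g.smul r)) ((f.tensor g).smul r)

/-- Objects of the strict `k`-linear monoidal category with generating objects `α`, generating
morphisms `G` and relations `R`: words in `α`. -/
@[ext]
structure Obj (R : ∀ ⦃a b : List α⦄, Term k G a b → Term k G a b → Prop) : Type where
  /-- the underlying word -/
  word : List α

variable {R : ∀ ⦃a b : List α⦄, Term k G a b → Term k G a b → Prop}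

/-- Morphisms: formal morphisms modulo the congruence generated by the relations. -/
def Hom (X Y : Obj R) : Type u :=
  Quot (Rel R (a := X.word) (b := Y.word))

/-- The class of a formal morphism. -/
def mk {X Y : Obj R} (f : Term k G X.word Y.word) : Hom X Y :=
  Quot.mk _ f

instance : Category (Obj R) where
  Hom X Y := Hom X Y
  id X := mk (Term.id X.word)
  comp {X Y Z} f g := Quot.map₂ (fun f g => f.comp g)
    (fun _ _ _ h => Rel.comp_congr (Rel.refl _) h)
    (fun _ _ _ h => Rel.comp_congr h (Rel.refl _)) f g
  id_comp := by
    rintro X Y ⟨f⟩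
    exact Quot.sound (Rel.id_comp f)
  comp_id := by
    rintro X Y ⟨f⟩
    exact Quot.sound (Rel.comp_id f)
  assoc := by
    rintro W X Y Z ⟨f⟩ ⟨g⟩ ⟨h⟩
    exact Quot.sound (Rel.comp_assoc f g h)

/-- The class of a formal morphism, as a morphism of the category. -/
def ofTerm (R : ∀ ⦃a b : List α⦄, Term k G a b → Term k G a b → Prop) {a b : List α}
    (f : Term k G a b) : (⟨a⟩ : Obj R) ⟶ ⟨b⟩ :=
  mk (X := ⟨a⟩) (Y := ⟨b⟩) f

instance (X Y : Obj R) : Zero (X ⟶ Y) where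
  zero := mk (Term.zero _ _)

instance (X Y : Obj R) : Add (X ⟶ Y) where
  add f g := Quot.map₂ (fun f g => f.add g)
    (fun _ _ _ h => Rel.add_congr (Rel.refl _) h)
    (fun _ _ _ h => Rel.add_congr h (Rel.refl _)) f g

instance (X Y : Obj R) : Neg (X ⟶ Y) where
  neg f := Quot.map (fun f => f.smul (-1)) (fun _ _ h => Rel.smul_congr _ h) f

instance (X Y : Obj R) : AddCommGroup (X ⟶ Y) where
  add_assoc := by
    rintro ⟨f⟩ ⟨g⟩ ⟨h⟩
    exact Quot.sound (Rel.add_assoc f g h)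
  zero_add := by
    rintro ⟨f⟩
    exact Quot.sound (Rel.zero_add f)
  add_zero := by
    rintro ⟨f⟩
    exact Quot.sound ((Rel.add_comm _ _).trans (Rel.zero_add f))
  add_comm := by
    rintro ⟨f⟩ ⟨g⟩
    exact Quot.sound (Rel.add_comm f g)
  neg_add_cancel := by
    rintro ⟨f⟩
    refine Quot.sound ?_
    refine (Rel.add_congr (Rel.refl _) (Rel.one_smul f).symm).trans
      ((Rel.add_smul (-1) 1 f).symm.trans ?_)
    rw [neg_add_cancel]
    exact Rel.zero_smul f
  nsmul := nsmulRec
  zsmul := zsmulRec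

instance (X Y : Obj R) : Module k (X ⟶ Y) where
  smul r f := Quot.map (fun f => f.smul r) (fun _ _ h => Rel.smul_congr r h) f
  one_smul := by
    rintro ⟨f⟩
    exact Quot.sound (Rel.one_smul f)
  mul_smul := by
    rintro r s ⟨f⟩
    exact Quot.sound (Rel.mul_smul r s f)
  smul_zero := by
    intro r
    refine Quot.sound ?_
    refine (Rel.smul_congr r (Rel.zero_smul (Term.zero _ _)).symm).trans
      ((Rel.mul_smul r 0 _).symm.trans ?_)
    rw [mul_zero]
    exact Rel.zero_smul _
  smul_add := by
    rintro r ⟨f⟩ ⟨g⟩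
    exact Quot.sound (Rel.smul_add r f g)
  add_smul := by
    rintro r s ⟨f⟩
    exact Quot.sound (Rel.add_smul r s f)
  zero_smul := by
    rintro ⟨f⟩
    exact Quot.sound (Rel.zero_smul f)

instance : Preadditive (Obj R) where
  add_comp := by
    rintro X Y Z ⟨f⟩ ⟨f'⟩ ⟨g⟩
    exact Quot.sound (Rel.add_comp f f' g)
  comp_add := by
    rintro X Y Z ⟨f⟩ ⟨g⟩ ⟨g'⟩
    exact Quot.sound (Rel.comp_add f g g')

instance : Linear k (Obj R) where
  smul_comp := by
    rintro X Y Z r ⟨f⟩ ⟨g⟩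
    exact Quot.sound (Rel.smul_comp r f g)
  comp_smul := by
    rintro X Y Z ⟨f⟩ r ⟨g⟩
    exact Quot.sound (Rel.comp_smul r f g)

/-- The tensor product of morphisms. -/
def tensorMor {W X Y Z : Obj R} (f : W ⟶ X) (g : Y ⟶ Z) :
    (⟨W.word ++ Y.word⟩ : Obj R) ⟶ ⟨X.word ++ Z.word⟩ :=
  Quot.map₂ (fun f g => f.tensor g)
    (fun _ _ _ h => Rel.tensor_congr (Rel.refl _) h)
    (fun _ _ _ h => Rel.tensor_congr h (Rel.refl _)) f g

theorem mk_cast {a b a' b' : List α} (ha : a = a') (hb : b = b') (f : Term k G a b) :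
    ofTerm R (f.cast ha hb) = eqToHom (by rw [ha]) ≫ ofTerm R f ≫ eqToHom (by rw [hb]) := by
  subst ha hb
  simp [Term.cast]

/-- The tensor product is concatenation on objects; the associator and the unitors are
identities (up to the equality of the words in question). -/
instance : MonoidalCategoryStruct (Obj R) where
  tensorObj X Y := ⟨X.word ++ Y.word⟩
  tensorUnit := ⟨[]⟩
  tensorHom f g := tensorMor f g
  whiskerLeft X _ _ f := tensorMor (𝟙 X) f
  whiskerRight f Y := tensorMor f (𝟙 Y)
  associator X Y Z := eqToIso (by rw [List.append_assoc])
  leftUnitor X := eqToIso rfl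
  rightUnitor X := eqToIso (by rw [List.append_nil])

theorem tensorMor_id (X Y : Obj R) : tensorMor (𝟙 X) (𝟙 Y) = 𝟙 (X ⊗ Y) :=
  Quot.sound (Rel.id_tensor_id _ _)

theorem tensorMor_eqToHom_left {X X' : Obj R} (h : X = X') (Y : Obj R) :
    tensorMor (eqToHom h) (𝟙 Y) = eqToHom (by rw [h]) := by
  subst h
  exact tensorMor_id X Y

theorem tensorMor_eqToHom_right {X X' : Obj R} (h : X = X') (Y : Obj R) :
    tensorMor (𝟙 Y) (eqToHom h) = eqToHom (by rw [h]) := by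
  subst h
  exact tensorMor_id Y X

instance : MonoidalCategory (Obj R) := MonoidalCategory.ofTensorHom
  (id_tensorHom_id := fun X Y => tensorMor_id X Y)
  (id_tensorHom := fun _ _ _ _ => rfl)
  (tensorHom_id := fun _ _ => rfl)
  (tensorHom_comp_tensorHom := by
    rintro X₁ Y₁ Z₁ X₂ Y₂ Z₂ ⟨f₁⟩ ⟨f₂⟩ ⟨g₁⟩ ⟨g₂⟩
    exact Quot.sound (Rel.tensor_comp_tensor f₁ g₁ f₂ g₂))
  (associator_naturality := by
    rintro X₁ X₂ X₃ Y₁ Y₂ Y₃ ⟨f⟩ ⟨g⟩ ⟨h⟩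
    have key := (mk_cast (R := R) _ _ _).symm.trans
      (Quot.sound (Rel.tensor_assoc (R := R) f g h))
    have key' := congrArg (fun m => eqToHom (congrArg Obj.mk
      (List.append_assoc X₁.word X₂.word X₃.word)) ≫ m) key
    simp only [eqToHom_trans_assoc, eqToHom_refl, Category.id_comp] at key'
    exact key')
  (leftUnitor_naturality := by
    rintro X Y ⟨f⟩
    refine (Category.comp_id _).trans (Eq.trans ?_ (Category.id_comp _).symm)
    exact Quot.sound (Rel.id_nil_tensor f))
  (rightUnitor_naturality := by
    rintro X Y ⟨f⟩
    have key := (mk_cast (R := R) _ _ _).symm.trans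
      (Quot.sound (Rel.tensor_id_nil (R := R) f))
    have key' := congrArg (fun m => eqToHom (congrArg Obj.mk
      (List.append_nil X.word)) ≫ m) key
    simp only [eqToHom_trans_assoc, eqToHom_refl, Category.id_comp] at key'
    exact key')
  (pentagon := by
    intro W X Y Z
    change tensorMor (eqToHom (congrArg Obj.mk (List.append_assoc W.word X.word Y.word))) (𝟙 Z) ≫
        eqToHom (congrArg Obj.mk (List.append_assoc W.word (X.word ++ Y.word) Z.word)) ≫
          tensorMor (𝟙 W) (eqToHom (congrArg Obj.mk (List.append_assoc X.word Y.word Z.word))) =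
      eqToHom (congrArg Obj.mk (List.append_assoc (W.word ++ X.word) Y.word Z.word)) ≫
        eqToHom (congrArg Obj.mk (List.append_assoc W.word X.word (Y.word ++ Z.word)))
    rw [tensorMor_eqToHom_left, tensorMor_eqToHom_right]
    simp only [eqToHom_trans])
  (triangle := by
    intro X Y
    change eqToHom (congrArg Obj.mk (List.append_assoc X.word [] Y.word)) ≫
        tensorMor (𝟙 X) (eqToHom (rfl : Y = Y)) =
      tensorMor (eqToHom (congrArg Obj.mk (List.append_nil X.word))) (𝟙 Y)
    rw [tensorMor_eqToHom_left, tensorMor_eqToHom_right]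
    simp only [eqToHom_trans])

instance : MonoidalPreadditive (Obj R) where
  whiskerLeft_zero := by
    intro X Y Z
    refine Quot.sound ?_
    exact (Rel.tensor_congr (Rel.refl _) (Rel.zero_smul (Term.zero _ _)).symm).trans
      ((Rel.tensor_smul 0 _ _).trans (Rel.zero_smul _))
  zero_whiskerRight := by
    intro X Y Z
    refine Quot.sound ?_
    exact (Rel.tensor_congr (Rel.zero_smul (Term.zero _ _)).symm (Rel.refl _)).trans
      ((Rel.smul_tensor 0 _ _).trans (Rel.zero_smul _))
  whiskerLeft_add := by
    rintro X Y Z ⟨f⟩ ⟨g⟩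
    exact Quot.sound (Rel.tensor_add _ f g)
  add_whiskerRight := by
    rintro X Y Z ⟨f⟩ ⟨g⟩
    exact Quot.sound (Rel.add_tensor f g _)

instance : MonoidalLinear k (Obj R) where
  whiskerLeft_smul := by
    rintro X Y Z r ⟨f⟩
    exact Quot.sound (Rel.tensor_smul r _ f)
  smul_whiskerRight := by
    rintro r Y Z ⟨f⟩ X
    exact Quot.sound (Rel.smul_tensor r f _)

end Congruence

end StrictPresentation

/-! ### Left tensor ideals -/

section LeftTensorIdeals

variable (k : Type*) [CommRing k] (C : Type*) [Category C] [Preadditive C] [Linear k C]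
  [MonoidalCategory C]

/-- A `k`-linear left tensor ideal of a `k`-linear monoidal category: a family of submodules of
the morphism spaces which is closed under composition with arbitrary morphisms on either side and
under tensoring with arbitrary morphisms on the left. -/
@[ext]
structure LeftTensorIdeal where
  /-- the morphisms `X ⟶ Y` in the ideal -/
  hom (X Y : C) : Submodule k (X ⟶ Y)
  precomp_mem {X Y Z : C} (g : X ⟶ Y) {f : Y ⟶ Z} : f ∈ hom Y Z → g ≫ f ∈ hom X Z
  postcomp_mem {X Y Z : C} {f : X ⟶ Y} (g : Y ⟶ Z) : f ∈ hom X Y → f ≫ g ∈ hom X Z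
  tensor_mem {W X Y Z : C} (g : W ⟶ X) {f : Y ⟶ Z} :
    f ∈ hom Y Z → g ⊗ₘ f ∈ hom (W ⊗ Y) (X ⊗ Z)

variable {C}

/-- The left tensor ideal generated by a class of morphisms: the intersection of all left tensor
ideals that contain it. -/
def LeftTensorIdeal.span (S : ∀ ⦃X Y : C⦄, (X ⟶ Y) → Prop) : LeftTensorIdeal k C where
  hom X Y := ⨅ I : { I : LeftTensorIdeal k C //
    ∀ ⦃X Y : C⦄ (f : X ⟶ Y), S f → f ∈ I.hom X Y }, I.1.hom X Y
  precomp_mem g f hf := by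
    rw [Submodule.mem_iInf] at hf ⊢
    exact fun I => I.1.precomp_mem g (hf I)
  postcomp_mem g hf := by
    rw [Submodule.mem_iInf] at hf ⊢
    exact fun I => I.1.postcomp_mem g (hf I)
  tensor_mem g f hf := by
    rw [Submodule.mem_iInf] at hf ⊢
    exact fun I => I.1.tensor_mem g (hf I)

end LeftTensorIdeals

/-! ### Endomorphisms of the unit object -/

theorem endUnit_comp_comm {C : Type*} [Category C] [MonoidalCategory C] (f g : 𝟙_ C ⟶ 𝟙_ C) :
    f ≫ g = g ≫ f := by
  have h := whisker_exchange f g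
  rw [id_whiskerLeft, whiskerRight_id, unitors_equal] at h
  simpa [unitors_inv_equal] using h.symm

/-- The endomorphisms of the unit object of a preadditive monoidal category form a commutative
ring. -/
instance endUnitCommRing {C : Type*} [Category C] [Preadditive C] [MonoidalCategory C] :
    CommRing (End (𝟙_ C)) where
  __ := (inferInstance : Ring (End (𝟙_ C)))
  mul_comm f g := endUnit_comp_comm g f

/-! ### The Heisenberg category -/

namespace Heisenberg

open StrictPresentation

/-- The two generating objects. -/
inductive Strand
  | up
  | down

open Strand

/-- The generating morphisms of the Heisenberg category of central charge `κ`: the dot `x`, the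
crossing `s`, the rightward cup `c` and cap `d`, and the entries of the formal inverse of the
matrix in the inversion relation, that is, the leftward crossing `t' : ↓ ⊗ ↑ ⟶ ↑ ⊗ ↓`, the
decorated cups `1 ⟶ ↑ ⊗ ↓` for `0 ≤ r < κ`, and the decorated caps `↓ ⊗ ↑ ⟶ 1` for
`0 ≤ r < -κ`. -/
inductive Gen (κ : ℤ) : List Strand → List Strand → Type
  | x : Gen κ [up] [up]
  | s : Gen κ [up, up] [up, up]
  | c : Gen κ [] [down, up]
  | d : Gen κ [up, down] []
  | t' : Gen κ [down, up] [up, down]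
  | decCup (r : Fin κ.toNat) : Gen κ [] [up, down]
  | decCap (r : Fin (-κ).toNat) : Gen κ [down, up] []

section Relations

/-- vertical composition in diagrammatic order: `f ⊳ g` is `g` drawn above `f` -/
local infixl:65 " ⊳ " => Term.comp

/-- horizontal composition: `f ⊠ g` is `f` drawn to the left of `g` -/
local notation:70 f:71 " ⊠ " g:70 => (Term.tensor f g :)

variable (k : Type u) (κ : ℤ)

/-- The dot, as a formal morphism. -/
abbrev xT : Term k (Gen κ) [up] [up] := .gen .x

/-- The crossing, as a formal morphism. -/
abbrev sT : Term k (Gen κ) [up, up] [up, up] := .gen .s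

/-- The rightward cup, as a formal morphism. -/
abbrev cT : Term k (Gen κ) [] [down, up] := .gen .c

/-- The rightward cap, as a formal morphism. -/
abbrev dT : Term k (Gen κ) [up, down] [] := .gen .d

/-- The leftward crossing, as a formal morphism. -/
abbrev t'T : Term k (Gen κ) [down, up] [up, down] := .gen .t'

/-- The decorated cups, as formal morphisms. -/
abbrev decCupT (r : Fin κ.toNat) : Term k (Gen κ) [] [up, down] := .gen (.decCup r)

/-- The decorated caps, as formal morphisms. -/
abbrev decCapT (r : Fin (-κ).toNat) : Term k (Gen κ) [down, up] [] := .gen (.decCap r)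

/-- Formal identity morphisms. -/
abbrev idT (w : List Strand) : Term k (Gen κ) w w := .id w

/-- The rightward crossing `↑ ⊗ ↓ ⟶ ↓ ⊗ ↑`, as a formal morphism. -/
def tT : Term k (Gen κ) [up, down] [down, up] :=
  (cT k κ ⊠ idT k κ [up, down]) ⊳ (idT k κ [down] ⊠ sT k κ ⊠ idT k κ [down]) ⊳
    (idT k κ [down, up] ⊠ dT k κ)

/-- The cup `c` with `r` dots on its right (upward) strand. -/
def dotCupT (r : ℕ) : Term k (Gen κ) [] [down, up] :=
  cT k κ ⊳ (idT k κ [down] ⊠ (xT k κ).pow r)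

/-- The cap `d` with `r` dots on its left (upward) strand. -/
def dotCapT (r : ℕ) : Term k (Gen κ) [up, down] [] :=
  ((xT k κ).pow r ⊠ idT k κ [down]) ⊳ dT k κ

/-- The defining relations of the Heisenberg category: the degenerate Hecke relations, the right
adjunction relations, and the inversion relation. The latter says that
`[t, d, d ∘ (x ⊗ 1), …, d ∘ (x ^ (κ - 1) ⊗ 1)]ᵀ : ↑ ⊗ ↓ ⟶ ↓ ⊗ ↑ ⊕ 1 ^ κ` (if `0 ≤ κ`) has the
two-sided inverse `[t', decCup 0, …, decCup (κ - 1)]`, and that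
`[t, c, (1 ⊗ x) ∘ c, …, (1 ⊗ x ^ (-κ - 1)) ∘ c] : ↑ ⊗ ↓ ⊕ 1 ^ (-κ) ⟶ ↓ ⊗ ↑` (if `κ < 0`) has the
two-sided inverse `[t', decCap 0, …, decCap (-κ - 1)]ᵀ`; it is spelled out in terms of matrix
entries. -/
inductive Relation [CommRing k] :
    ∀ ⦃a b : List Strand⦄, Term k (Gen κ) a b → Term k (Gen κ) a b → Prop
  | s_sq : Relation (a := [up, up]) (b := [up, up])
      (sT k κ ⊳ sT k κ) (idT k κ [up, up])
  | braid : Relation (a := [up, up, up]) (b := [up, up, up])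
      ((sT k κ ⊠ idT k κ [up]) ⊳ (idT k κ [up] ⊠ sT k κ) ⊳ (sT k κ ⊠ idT k κ [up]))
      ((idT k κ [up] ⊠ sT k κ) ⊳ (sT k κ ⊠ idT k κ [up]) ⊳ (idT k κ [up] ⊠ sT k κ))
  | dot_slide : Relation (a := [up, up]) (b := [up, up])
      (sT k κ ⊳ (xT k κ ⊠ idT k κ [up]))
      (((idT k κ [up] ⊠ xT k κ) ⊳ sT k κ).add (idT k κ [up, up]))
  | adj_up : Relation (a := [up]) (b := [up])
      ((idT k κ [up] ⊠ cT k κ) ⊳ (dT k κ ⊠ idT k κ [up])) (idT k κ [up])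
  | adj_down : Relation (a := [down]) (b := [down])
      ((cT k κ ⊠ idT k κ [down]) ⊳ (idT k κ [down] ⊠ dT k κ)) (idT k κ [down])
  | inv_up_down : Relation (a := [up, down]) (b := [up, down])
      ((tT k κ ⊳ t'T k κ).add
        (Term.sum fun r : Fin κ.toNat => dotCapT k κ r ⊳ decCupT k κ r))
      (idT k κ [up, down])
  | inv_down_up : Relation (a := [down, up]) (b := [down, up])
      ((t'T k κ ⊳ tT k κ).add
        (Term.sum fun r : Fin (-κ).toNat => decCapT k κ r ⊳ dotCupT k κ r))
      (idT k κ [down, up])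
  | decCup_t (r : Fin κ.toNat) : Relation (a := []) (b := [down, up])
      (decCupT k κ r ⊳ tT k κ) (.zero [] [down, up])
  | t'_dotCap (r : Fin κ.toNat) : Relation (a := [down, up]) (b := [])
      (t'T k κ ⊳ dotCapT k κ r) (.zero [down, up] [])
  | decCup_dotCap_self (r : Fin κ.toNat) : Relation (a := []) (b := [])
      (decCupT k κ r ⊳ dotCapT k κ r) (idT k κ [])
  | decCup_dotCap_ne (r s : Fin κ.toNat) (h : r ≠ s) : Relation (a := []) (b := [])
      (decCupT k κ r ⊳ dotCapT k κ s) (.zero [] [])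
  | dotCup_t' (r : Fin (-κ).toNat) : Relation (a := []) (b := [up, down])
      (dotCupT k κ r ⊳ t'T k κ) (.zero [] [up, down])
  | t_decCap (r : Fin (-κ).toNat) : Relation (a := [up, down]) (b := [])
      (tT k κ ⊳ decCapT k κ r) (.zero [up, down] [])
  | dotCup_decCap_self (r : Fin (-κ).toNat) : Relation (a := []) (b := [])
      (dotCupT k κ r ⊳ decCapT k κ r) (idT k κ [])
  | dotCup_decCap_ne (r s : Fin (-κ).toNat) (h : r ≠ s) : Relation (a := []) (b := [])
      (dotCupT k κ r ⊳ decCapT k κ s) (.zero [] [])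

end Relations

section Morphisms

variable (k : Type u) [CommRing k] (κ : ℤ)

/-- The Heisenberg category of central charge `κ` over `k`, a strict `k`-linear monoidal
category. -/
abbrev Heis : Type := Obj (Relation k κ)

/-- The object `↑`. -/
def upObj : Heis k κ := ⟨[up]⟩

/-- The object `↓`. -/
def downObj : Heis k κ := ⟨[down]⟩

/-- The upward dot. -/
def x : End (upObj k κ) := ofTerm (Relation k κ) (.gen .x)

/-- The rightward cup. -/
def c : 𝟙_ (Heis k κ) ⟶ downObj k κ ⊗ upObj k κ := ofTerm (Relation k κ) (.gen .c)

/-- The rightward cap. -/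
def d : upObj k κ ⊗ downObj k κ ⟶ 𝟙_ (Heis k κ) := ofTerm (Relation k κ) (.gen .d)

/-- The leftward crossing. -/
def t' : downObj k κ ⊗ upObj k κ ⟶ upObj k κ ⊗ downObj k κ :=
  ofTerm (Relation k κ) (.gen .t')

/-- The decorated leftward cups. -/
def decCup (r : Fin κ.toNat) : 𝟙_ (Heis k κ) ⟶ upObj k κ ⊗ downObj k κ :=
  ofTerm (Relation k κ) (.gen (.decCup r))

/-- The decorated leftward caps. -/
def decCap (r : Fin (-κ).toNat) : downObj k κ ⊗ upObj k κ ⟶ 𝟙_ (Heis k κ) :=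
  ofTerm (Relation k κ) (.gen (.decCap r))

/-- The downward dot `x'`, the right mate of `x`. -/
def x' : End (downObj k κ) :=
  (λ_ (downObj k κ)).inv ≫ c k κ ▷ downObj k κ ≫
    (α_ (downObj k κ) (upObj k κ) (downObj k κ)).hom ≫
      downObj k κ ◁ (x k κ ▷ downObj k κ ≫ d k κ) ≫ (ρ_ (downObj k κ)).hom

/-- The leftward cup `c'`. -/
def c' : 𝟙_ (Heis k κ) ⟶ upObj k κ ⊗ downObj k κ :=
  if h : 0 < κ then -decCup k κ ⟨(κ - 1).toNat, by omega⟩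
  else c k κ ≫ downObj k κ ◁ (x k κ ^ (-κ).toNat : End (upObj k κ)) ≫ t' k κ

/-- The leftward cap `d'`. -/
def d' : downObj k κ ⊗ upObj k κ ⟶ 𝟙_ (Heis k κ) :=
  if h : κ < 0 then decCap k κ ⟨(-κ - 1).toNat, by omega⟩
  else t' k κ ≫ (x k κ ^ κ.toNat : End (upObj k κ)) ▷ downObj k κ ≫ d k κ

/-- The counterclockwise bubble with `n ≥ 0` dots. -/
def ccwNat (n : ℕ) : End (𝟙_ (Heis k κ)) :=
  c k κ ≫ downObj k κ ◁ (x k κ ^ n : End (upObj k κ)) ≫ d' k κ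

/-- The clockwise bubble with `n ≥ 0` dots. -/
def cwNat (n : ℕ) : End (𝟙_ (Heis k κ)) :=
  c' k κ ≫ (x k κ ^ n : End (upObj k κ)) ▷ downObj k κ ≫ d k κ

/-- The counterclockwise bubble of degree `n ∈ ℤ`. For `n = r - κ - 1 < 0`, i.e. `r ≤ κ`, it is
the determinant of the clockwise bubbles of degree `i - j + κ > 0`, `1 ≤ i, j ≤ r`, to be read
as `1` if `r = 0` and as `0` if `r < 0`. -/
noncomputable def ccw (n : ℤ) : End (𝟙_ (Heis k κ)) :=
  if 0 ≤ n then ccwNat k κ n.toNat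
  else if n + κ + 1 < 0 then 0
  else (Matrix.of fun i j : Fin (n + κ + 1).toNat =>
    cwNat k κ ((i : ℤ) - (j : ℤ) + κ).toNat).det

/-- The clockwise bubble of degree `n ∈ ℤ`. For `n = r + κ - 1 < 0`, i.e. `r ≤ -κ`, it is minus
the determinant of the negatives of the counterclockwise bubbles of degree `i - j - κ > 0`,
`1 ≤ i, j ≤ r`, the determinant to be read as `1` if `r = 0` and as `0` if `r < 0`. -/
noncomputable def cw (n : ℤ) : End (𝟙_ (Heis k κ)) :=
  if 0 ≤ n then cwNat k κ n.toNat
  else if n - κ + 1 < 0 then 0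
  else -(Matrix.of fun i j : Fin (n - κ + 1).toNat =>
    -ccwNat k κ ((i : ℤ) - (j : ℤ) - κ).toNat).det

end Morphisms

/-! ### Generalized cyclotomic ideals -/

section Cyclotomic

variable {k : Type u} [CommRing k]

/-- For monic `f`, `f'` of degrees `ℓ`, `ℓ'` and `κ = ℓ' - ℓ`, the power series
`u ^ (-κ) * f'(u) / f(u) = (u ^ (-ℓ') * f'(u)) / (u ^ (-ℓ) * f(u))` in the variable `u⁻¹`. Note
that `u ^ (-ℓ) * f(u)` is the reversed polynomial of `f`, evaluated at `u⁻¹`; its constant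
coefficient is `1`. -/
noncomputable def deltaSeries (f f' : k[X]) : PowerSeries k :=
  (f'.reverse : PowerSeries k) * PowerSeries.invOfUnit (f.reverse : PowerSeries k) 1

/-- For monic `f`, `f'` of degrees `ℓ`, `ℓ'` and `κ = ℓ' - ℓ`, the power series
`-u ^ κ * f(u) / f'(u)` in the variable `u⁻¹`. -/
noncomputable def deltaSeries' (f f' : k[X]) : PowerSeries k :=
  -((f.reverse : PowerSeries k) * PowerSeries.invOfUnit (f'.reverse : PowerSeries k) 1)

/-- The scalar `δ_r`. -/
noncomputable def delta (f f' : k[X]) (r : ℕ) : k := PowerSeries.coeff r (deltaSeries f f')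

/-- The scalar `δ'_r`. -/
noncomputable def delta' (f f' : k[X]) (r : ℕ) : k := PowerSeries.coeff r (deltaSeries' f f')

variable (κ : ℤ) (f f' : k[X])

/-- The morphism `ccw_{r - κ - 1} - δ_r 1`. -/
noncomputable def ccwRel (r : ℕ) : 𝟙_ (Heis k κ) ⟶ 𝟙_ (Heis k κ) :=
  ccw k κ ((r : ℤ) - κ - 1) - delta f f' r • (1 : End (𝟙_ (Heis k κ)))

/-- The morphism `cw_{r + κ - 1} - δ'_r 1`. -/
noncomputable def cwRel (r : ℕ) : 𝟙_ (Heis k κ) ⟶ 𝟙_ (Heis k κ) :=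
  cw k κ ((r : ℤ) + κ - 1) - delta' f f' r • (1 : End (𝟙_ (Heis k κ)))

/-- The morphism `f(x) : ↑ ⟶ ↑`. -/
noncomputable def polyUp : upObj k κ ⟶ upObj k κ := aeval (x k κ) f

/-- The morphism `f'(x') : ↓ ⟶ ↓`. -/
noncomputable def polyDown : downObj k κ ⟶ downObj k κ := aeval (x' k κ) f'

/-- The morphisms `f(x)` and `ccw_{r - κ - 1} - δ_r 1` for `1 ≤ r ≤ deg f'`. -/
inductive IsGenUp : ∀ ⦃X Y : Heis k κ⦄, (X ⟶ Y) → Prop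
  | poly : IsGenUp (polyUp κ f)
  | bubble (r : ℕ) (h₁ : 1 ≤ r) (h₂ : r ≤ f'.natDegree) : IsGenUp (ccwRel κ f f' r)

/-- The morphisms `f'(x')` and `cw_{r + κ - 1} - δ'_r 1` for `1 ≤ r ≤ deg f`. -/
inductive IsGenDown : ∀ ⦃X Y : Heis k κ⦄, (X ⟶ Y) → Prop
  | poly : IsGenDown (polyDown κ f')
  | bubble (r : ℕ) (h₁ : 1 ≤ r) (h₂ : r ≤ f.natDegree) : IsGenDown (cwRel κ f f' r)

/-- The left tensor ideal whose quotient is the generalized cyclotomic quotient of the Heisenberg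
category. -/
def cyclotomicIdeal : LeftTensorIdeal k (Heis k κ) :=
  LeftTensorIdeal.span k (IsGenUp κ f f')

end Cyclotomic

end Heisenberg

/-! Collect the bubbles into two power series over the commutative ring `End (𝟙_ _)`: `ccwSeries`,
with r-th coefficient the counterclockwise bubble of degree r - κ - 1, and `cwSeries`, with r-th
coefficient minus the clockwise bubble of degree r + κ - 1. The infinite Grassmannian relation
`ccwSeries_mul_cwSeries` says that they are mutually inverse. The scalar series δ and -δ' are also
mutually inverse, so modulo a left tensor ideal all counterclockwise bubbles are the prescribed
scalars if and only if all clockwise ones are.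

Write F and F' for the reversed polynomials of f and f', so that δF = F'. Above degree ℓ' the
coefficients of `ccwSeries`·F are counterclockwise bubbles carrying f(x) (`ccwBubble_polyUp`), hence
lie in the ideal, while F' has no such coefficients. As F has constant coefficient 1, the
congruences in degrees at most ℓ' spread to every degree (`ccwRel_mem`).

To get from f(x) to f'(x'), put f(x) on the curl formed by t and d'. The curl relation expands it in
dotted caps whose coefficients are those of `ccwSeries`·F in degrees at most ℓ' (`downCurl_polyUp`).
Modulo the ideal these are the coefficients of F', and the sum is d with f'(x') on its downward leg.
Bending that leg back with c needs tensoring on the left only, so f'(x') is in the ideal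
(`polyDown_mem`). The mirror argument, with c' and t, recovers f(x) from f'(x') (`polyUp_mem`).

The Grassmannian and curl relations follow from the dot slide and the inversion relation. Inserting
the resolution of the identity next to a dotted leftward cup or cap gives a unitriangular Toeplitz
system, solved by convolution with the inverse series. This is done abstractly, for an inverted
column (κ ≥ 0) and an inverted row (κ < 0). In negative degrees the bubbles are defined by
determinants, which are exactly the coefficients of an inverse series
(`coeff_eq_det_of_mul_eq_one`). -/

/-! ### Inverse power series and Toeplitz matrices -/

namespace PowerSeries

open Finset (range mem_sigma)
open Finset.HasAntidiagonal (antidiagonal mem_antidiagonal)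

/-- The coefficients of the inverse of a power series as Hessenberg–Toeplitz determinants. -/
theorem coeff_eq_det_of_mul_eq_one {R : Type*} [CommRing R] {A B : PowerSeries R}
    (hAB : A * B = 1) (hB : coeff 0 B = 1) (r : ℕ) :
    coeff r A = (Matrix.of fun i j : Fin r =>
      if (j : ℕ) ≤ i + 1 then -coeff (i + 1 - j : ℕ) B else 0).det := by
  set T : Matrix (Fin (r + 1)) (Fin (r + 1)) R :=
    Matrix.of fun i j => if (j : ℕ) ≤ i then coeff (i - j : ℕ) B else 0 with hT
  set a : Fin (r + 1) → R := fun i => coeff (i : ℕ) A with ha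
  have hTa : T.mulVec a = Pi.single 0 1 := by
    funext i
    have h := congrArg (coeff (i : ℕ)) hAB
    rw [coeff_mul, Finset.Nat.sum_antidiagonal_eq_sum_range_succ_mk, coeff_one] at h
    simp only [Matrix.mulVec, dotProduct, hT, ha, Matrix.of_apply]
    rw [Fin.sum_univ_eq_sum_range (fun l => (if l ≤ (i : ℕ) then coeff (i - l : ℕ) B else 0) *
      coeff l A)]
    rw [← Finset.sum_subset (s₁ := range ((i : ℕ) + 1))]
    · rw [Pi.single_apply]
      refine Eq.trans ?_ (h.trans ?_)
      · refine Finset.sum_congr rfl fun l hl => ?_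
        rw [if_pos (by simpa [Nat.lt_succ_iff] using hl), mul_comm]
      · exact if_congr (by rw [Fin.ext_iff]; rfl) rfl rfl
    · intro l hl
      have := i.2
      simp only [Finset.mem_range] at hl ⊢
      omega
    · intro l _ hl
      rw [if_neg (by simpa [Nat.lt_succ_iff] using hl), zero_mul]
  have hdet : T.det = 1 := by
    rw [Matrix.det_of_isLowerTriangular]
    · simp [hT, hB]
    · intro i j hij
      have : ¬ j ≤ i := by simpa using hij
      simp [hT, this]
  -- Cramer's rule for the unipotent system `T a = e₀`: the last unknown is the cofactor that
  -- deletes the first row and the last column. The sign (-1)^r of this cofactor is absorbed by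
  -- negating all r rows.
  have key : T.adjugate (Fin.last r) 0 = coeff r A := by
    have h : T.adjugate.mulVec (T.mulVec a) = a := by
      rw [Matrix.mulVec_mulVec, Matrix.adjugate_mul, hdet, one_smul, Matrix.one_mulVec]
    rw [hTa] at h
    have h' := congrFun h (Fin.last r)
    simpa [ha] using h'
  rw [← key, Matrix.adjugate_fin_succ_eq_det_submatrix]
  have hM : (Matrix.of fun i j : Fin r =>
      if (j : ℕ) ≤ i + 1 then -coeff (i + 1 - j : ℕ) B else 0) =
      -T.submatrix (Fin.succAbove 0) (Fin.succAbove (Fin.last r)) := by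
    ext i j
    simp only [hT, Matrix.of_apply, Matrix.neg_apply, Matrix.submatrix_apply, Fin.zero_succAbove,
      Fin.succAbove_last, Fin.val_succ, Fin.val_castSucc]
    split_ifs <;> simp
  rw [hM, Matrix.det_neg]
  simp

/-- Convolution with a power series, acting on a sequence in a module, is undone by convolution
with the inverse power series. -/
theorem eq_conv_of_eq_conv {R M : Type*} [CommRing R] [AddCommGroup M] [Module R M]
    {A B : PowerSeries R} (hAB : A * B = 1) {v w : ℕ → M} {N : ℕ}
    (h : ∀ s ≤ N, v s = ∑ p ∈ antidiagonal s, coeff p.1 B • w p.2) (s : ℕ) (hs : s ≤ N) :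
    w s = ∑ p ∈ antidiagonal s, coeff p.1 A • v p.2 := by
  have h1 : ∑ p ∈ antidiagonal s, coeff p.1 A • v p.2 =
      ∑ p ∈ antidiagonal s, ∑ q ∈ antidiagonal p.2, (coeff p.1 A * coeff q.1 B) • w q.2 := by
    refine Finset.sum_congr rfl fun p hp => ?_
    rw [mem_antidiagonal] at hp
    rw [h p.2 (by omega), Finset.smul_sum]
    exact Finset.sum_congr rfl fun q _ => (mul_smul _ _ _).symm
  -- Associativity of convolution; the inner sum then becomes a coefficient of `A * B = 1`.
  have h2 : ∑ p ∈ antidiagonal s, ∑ q ∈ antidiagonal p.2, (coeff p.1 A * coeff q.1 B) • w q.2 =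
      ∑ p ∈ antidiagonal s, ∑ q ∈ antidiagonal p.1, (coeff q.1 A * coeff q.2 B) • w p.2 := by
    rw [Finset.sum_sigma', Finset.sum_sigma']
    refine Finset.sum_nbij' (fun a => ⟨(a.1.1 + a.2.1, a.2.2), (a.1.1, a.2.1)⟩)
      (fun a => ⟨(a.2.1, a.2.2 + a.1.2), (a.2.2, a.1.2)⟩) ?_ ?_ ?_ ?_ ?_ <;>
    · rintro ⟨⟨a, b⟩, c, d⟩
      simp only [mem_sigma, mem_antidiagonal]
      rintro ⟨h1, h2⟩
      subst h1 h2
      simp [add_assoc]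
  rw [h1, h2]
  have h3 : ∀ p ∈ antidiagonal s, ∑ q ∈ antidiagonal p.1, (coeff q.1 A * coeff q.2 B) • w p.2 =
      if p.1 = 0 then w p.2 else 0 := by
    intro p _
    rw [← Finset.sum_smul, ← coeff_mul, hAB, coeff_one]
    split_ifs <;> simp
  rw [Finset.sum_congr rfl h3, Finset.Nat.sum_antidiagonal_eq_sum_range_succ_mk,
      Finset.sum_range_succ']
  simp

end PowerSeries

/-! ### Sliding powers of endomorphisms -/

namespace CategoryTheory

variable {C : Type*} [Category C] [Preadditive C]

/-- Telescoping: each of the n + 1 factors crosses `t` once and leaves a copy of `g`, with the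
factors already moved on one side and the rest on the other. -/
theorem comp_pow_of_comp_eq {P Q : C} {t g : P ⟶ Q} {X : End P} {Y : End Q}
    (h : t ≫ Y = X ≫ t + g) (n : ℕ) :
    t ≫ (Y ^ (n + 1) : End Q) = (X ^ (n + 1) : End P) ≫ t +
      ∑ p ∈ Finset.HasAntidiagonal.antidiagonal n, (X ^ p.1 : End P) ≫ g ≫ (Y ^ p.2 : End Q) := by
  induction n with
  | zero => simpa [End.one_def] using h
  | succ n ih =>
    rw [pow_succ' Y, End.mul_def, ← Category.assoc, ih, Finset.Nat.sum_antidiagonal_succ',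
      Preadditive.add_comp, Category.assoc, h, Preadditive.comp_add, Preadditive.sum_comp,
      pow_succ' X (n + 1), End.mul_def, pow_zero, End.one_def, Category.comp_id, Category.assoc,
      add_assoc]
    congr 2
    refine Finset.sum_congr rfl fun p _ => ?_
    rw [pow_succ' Y, End.mul_def, Category.assoc, Category.assoc]

end CategoryTheory

/-! ### Series of endomorphisms of the unit object, and the inversion relation for a column. -/

namespace CategoryTheory

open Finset (range)
open Finset.HasAntidiagonal (antidiagonal mem_antidiagonal)

variable {C : Type*} [Category C] [Preadditive C] [MonoidalCategory C]

/-- The coefficients of a power series over the endomorphism ring of the unit object, as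
morphisms. -/
noncomputable abbrev coeffHom (i : ℕ) (A : PowerSeries (End (𝟙_ C))) : 𝟙_ C ⟶ 𝟙_ C :=
  PowerSeries.coeff (R := End (𝟙_ C)) i A

/-- The endomorphism ring of the unit object acts on morphisms out of the unit object. -/
abbrev endUnitModule (P : C) : Module (End (𝟙_ C)) (𝟙_ C ⟶ P) where
  smul a f := a ≫ f
  one_smul f := Category.id_comp f
  mul_smul a b f := by
    change (a * b) ≫ f = a ≫ b ≫ f
    -- Precomposition is a priori a right action; commutativity of `End (𝟙_ C)` makes it a left one.
    rw [mul_comm, End.mul_def, Category.assoc]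
  smul_zero a := Limits.comp_zero
  smul_add a f g := Preadditive.comp_add _ _ _ _ _ _
  add_smul a b f := Preadditive.add_comp _ _ _ _ _ _
  zero_smul f := Limits.zero_comp

theorem eq_conv_of_eq_conv_comp {P : C} {A B : PowerSeries (End (𝟙_ C))} (hAB : A * B = 1)
    {v w : ℕ → (𝟙_ C ⟶ P)} {N : ℕ}
    (h : ∀ s ≤ N, v s = ∑ p ∈ antidiagonal s, coeffHom p.1 B ≫ w p.2) (s : ℕ) (hs : s ≤ N) :
    w s = ∑ p ∈ antidiagonal s, coeffHom p.1 A ≫ v p.2 :=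
  letI := endUnitModule P
  PowerSeries.eq_conv_of_eq_conv hAB (v := v) (w := w) h s hs

theorem eq_conv_of_eq_comp_conv {Q : C} {A B : PowerSeries (End (𝟙_ C))} (hAB : A * B = 1)
    {v w : ℕ → (Q ⟶ 𝟙_ C)} {N : ℕ}
    (h : ∀ s ≤ N, v s = ∑ p ∈ antidiagonal s, w p.2 ≫ coeffHom p.1 B) (s : ℕ) (hs : s ≤ N) :
    w s = ∑ p ∈ antidiagonal s, v p.2 ≫ coeffHom p.1 A :=
  PowerSeries.eq_conv_of_eq_conv hAB (v := v) (w := w) h s hs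

theorem sum_coeffHom_comp {A B : PowerSeries (End (𝟙_ C))} (hAB : A * B = 1) (n : ℕ) :
    ∑ p ∈ antidiagonal (n + 1), coeffHom p.1 A ≫ coeffHom p.2 B = 0 := by
  have h := congrArg (PowerSeries.coeff (n + 1)) hAB
  rw [PowerSeries.coeff_mul, PowerSeries.coeff_one, if_neg (by omega)] at h
  refine Eq.trans (Finset.sum_congr rfl fun p _ => ?_) h
  exact endUnit_comp_comm _ _

theorem coeffHom_succ_eq {A B : PowerSeries (End (𝟙_ C))} (hAB : A * B = 1)
    (hB : coeffHom 0 B = 𝟙 (𝟙_ C)) (n : ℕ) :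
    coeffHom (n + 1) A = -∑ p ∈ antidiagonal n, coeffHom p.1 A ≫ coeffHom (p.2 + 1) B := by
  have h := sum_coeffHom_comp hAB n
  rw [Finset.Nat.sum_antidiagonal_succ', hB, Category.comp_id] at h
  exact eq_neg_of_add_eq_zero_left h

theorem coeffHom_zero_eq {A B : PowerSeries (End (𝟙_ C))} (hAB : A * B = 1)
    (hB : coeffHom 0 B = 𝟙 (𝟙_ C)) : coeffHom 0 A = 𝟙 (𝟙_ C) := by
  have h := congrArg (PowerSeries.coeff 0) hAB
  rw [PowerSeries.coeff_mul, PowerSeries.coeff_one, if_pos rfl] at h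
  simp only [Finset.Nat.antidiagonal_zero, Finset.sum_singleton] at h
  rw [mul_comm] at h
  refine Eq.trans ?_ h
  rw [End.mul_def]
  change coeffHom 0 A = coeffHom 0 A ≫ coeffHom 0 B
  rw [hB, Category.comp_id]

/-- The two sums collect the pairs whose first index is at most `n`, respectively at least `n + 1`.
In applications the cut separates low degrees from those of honest dotted bubbles. -/
theorem _root_.Finset.Nat.sum_antidiagonal_add_add_one {M : Type*} [AddCommMonoid M]
    (f : ℕ → ℕ → M) (m n : ℕ) :
    ∑ p ∈ antidiagonal (m + n + 1), f p.1 p.2 =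
      ∑ p ∈ antidiagonal n, f p.1 (p.2 + m + 1) + ∑ p ∈ antidiagonal m, f (p.1 + n + 1) p.2 := by
  induction n generalizing f with
  | zero =>
    rw [Finset.Nat.sum_antidiagonal_succ]
    simp
  | succ n ih =>
    rw [Finset.Nat.sum_antidiagonal_succ, ← add_assoc m n 1, ih (fun a b => f (a + 1) b),
      Finset.Nat.sum_antidiagonal_succ (n := n), ← add_assoc]
    congr 2
    simp only [add_assoc, add_comm, add_left_comm]

variable {P Q : C}

/-- A two-sided inverse `[t', cup 0, …, cup (N - 1)]` of the column with entries `t`, `d` and its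
composites with powers of `X`, together with the leftward cup `c'` and cap `d'`. -/
structure ColumnInversion (N : ℕ) (t : P ⟶ Q) (t' : Q ⟶ P) (X : End P) (Y : End Q)
    (c : 𝟙_ C ⟶ Q) (d : P ⟶ 𝟙_ C) (cup : ℕ → (𝟙_ C ⟶ P)) (c' : 𝟙_ C ⟶ P) (d' : Q ⟶ 𝟙_ C) :
    Prop where
  slide : t ≫ Y = X ≫ t + d ≫ c
  comp_inv : t ≫ t' + ∑ r ∈ range N, ((X ^ r : End P) ≫ d) ≫ cup r = 𝟙 P
  inv_comp : t' ≫ t = 𝟙 Q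
  cup_comp (r : ℕ) : r < N → cup r ≫ t = 0
  inv_cap (r : ℕ) : r < N → t' ≫ (X ^ r : End P) ≫ d = 0
  cup_cap (r s : ℕ) : r < N → s < N → cup r ≫ (X ^ s : End P) ≫ d = if r = s then 𝟙 (𝟙_ C) else 0
  cup_zero : N = 0 → c' = c ≫ t'
  cup_succ (M : ℕ) : N = M + 1 → c' = -cup M
  cap_eq : d' = t' ≫ (X ^ N : End P) ≫ d

namespace ColumnInversion

variable {N : ℕ} {t : P ⟶ Q} {t' : Q ⟶ P} {X : End P} {Y : End Q}
    {c : 𝟙_ C ⟶ Q} {d : P ⟶ 𝟙_ C} {cup : ℕ → (𝟙_ C ⟶ P)} {c' : 𝟙_ C ⟶ P} {d' : Q ⟶ 𝟙_ C}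
    (H : ColumnInversion N t t' X Y c d cup c' d')
include H

theorem cup_dot_cap (s : ℕ) (hs : s < N) :
    c' ≫ (X ^ s : End P) ≫ d = if s + 1 = N then -𝟙 (𝟙_ C) else 0 := by
  obtain ⟨M, rfl⟩ : ∃ M, N = M + 1 := ⟨N - 1, by omega⟩
  rw [H.cup_succ M rfl, Preadditive.neg_comp, H.cup_cap M s (by omega) hs]
  rcases eq_or_ne s M with rfl | h
  · simp
  · rw [if_neg h.symm, if_neg (by omega), neg_zero]

theorem leftCup_comp : c' ≫ t = if N = 0 then c else 0 := by
  split_ifs with h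
  · rw [H.cup_zero h, Category.assoc, H.inv_comp, Category.comp_id]
  · obtain ⟨M, rfl⟩ : ∃ M, N = M + 1 := ⟨N - 1, by omega⟩
    rw [H.cup_succ M rfl, Preadditive.neg_comp, H.cup_comp M (by omega), neg_zero]

/-- Sandwich the dot slide between two copies of `t'`. If `N > 0`, the defect of `t ≫ t'` from the
identity consists of caps with `r` dots followed by `cup r`. The extra dot raises `r` by one, so
`t'` kills every term except `r = N - 1`, which is `-(d' ≫ c')`. If `N = 0`, there is no defect and
`d ≫ c` itself becomes `d' ≫ c'`. -/
theorem slide_inv : Y ≫ t' = t' ≫ X + d' ≫ c' := by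
  have h : t' ≫ (t ≫ Y) ≫ t' = Y ≫ t' := by
    rw [← Category.assoc, ← Category.assoc, H.inv_comp, Category.id_comp]
  have h1 : t ≫ t' = 𝟙 P - ∑ r ∈ range N, ((X ^ r : End P) ≫ d) ≫ cup r := by
    rw [← H.comp_inv, add_sub_cancel_right]
  rw [← h, H.slide]
  simp only [Preadditive.add_comp, Preadditive.comp_add, Category.assoc]
  rw [h1]
  rcases Nat.eq_zero_or_pos N with h0 | h0
  · subst h0
    have hd : d' = t' ≫ d := by
      have := H.cap_eq
      rwa [pow_zero, End.one_def, Category.id_comp] at this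
    rw [Finset.range_zero, Finset.sum_empty, sub_zero, Category.comp_id, hd, H.cup_zero rfl,
      Category.assoc]
  · obtain ⟨M, rfl⟩ : ∃ M, N = M + 1 := ⟨N - 1, by omega⟩
    have h2 : t' ≫ d = 0 := by
      have := H.inv_cap 0 h0
      rwa [pow_zero, End.one_def, Category.id_comp] at this
    have h3 : ∀ r, X ≫ (X ^ r : End P) ≫ d = (X ^ (r + 1) : End P) ≫ d := fun r => by
      rw [pow_succ, End.mul_def, Category.assoc]
    rw [reassoc_of% h2, Limits.zero_comp, add_zero, Preadditive.comp_sub, Preadditive.comp_sub,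
      Category.comp_id, Preadditive.comp_sum, Preadditive.comp_sum, Finset.sum_range_succ,
      Finset.sum_eq_zero, zero_add, ← Category.assoc X, h3, ← Category.assoc t', ← H.cap_eq,
      H.cup_succ M rfl, Preadditive.comp_neg, sub_eq_add_neg]
    intro r hr
    rw [← Category.assoc X, h3, ← Category.assoc t', H.inv_cap _ (by simpa using hr),
      Limits.zero_comp]

variable {A B : PowerSeries (End (𝟙_ C))} (hAB : A * B = 1) (hB0 : coeffHom 0 B = 𝟙 (𝟙_ C))
  (hB : ∀ i m, i + N = m + 1 → coeffHom i B = -(c' ≫ (X ^ m : End P) ≫ d))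
include hB0 hB

/-- Inserting the resolution of `𝟙 P` after the dots produces clockwise bubbles times the cups, plus
one term through `t`. With `c ≫ t'` appended to the reversed list of negated cups, this is
convolution with the unipotent series `B`, ready to be inverted. -/
theorem leftCup_dot_eq_sum (s : ℕ) (hs : s ≤ N) : c' ≫ (X ^ s : End P) =
    ∑ p ∈ antidiagonal s, coeffHom p.1 B ≫ (if p.2 < N then -cup (N - 1 - p.2) else c ≫ t') := by
  rcases Nat.eq_zero_or_pos N with h0 | h0
  · subst h0
    obtain rfl : s = 0 := by omega
    simp [hB0, End.one_def, H.cup_zero rfl]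
  obtain ⟨M, rfl⟩ : ∃ M, N = M + 1 := ⟨N - 1, by omega⟩
  have h1 : c' ≫ (X ^ s : End P) = (c' ≫ (X ^ s : End P) ≫ t) ≫ t' +
      ∑ r ∈ range (M + 1), (c' ≫ (X ^ (r + s) : End P) ≫ d) ≫ cup r := by
    conv_lhs => rw [← Category.comp_id (X ^ s : End P), ← H.comp_inv]
    simp only [Preadditive.comp_add, Preadditive.comp_sum, Category.assoc, pow_add, End.mul_def]
  -- Sliding the dots through `t` leaves bubbles with fewer than `N` dots. Only the one with `N - 1`
  -- dots is nonzero, and it needs `s = N`.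
  have h2 : c' ≫ (X ^ s : End P) ≫ t = if s = M + 1 then c else 0 := by
    rcases s with _ | s
    · rw [pow_zero, End.one_def, Category.id_comp, H.leftCup_comp, if_neg (by omega),
        if_neg (by omega)]
    · have h3 := comp_pow_of_comp_eq H.slide s
      rw [← sub_eq_iff_eq_add] at h3
      rw [← h3, Preadditive.comp_sub, ← Category.assoc, H.leftCup_comp, if_neg (by omega),
        Limits.zero_comp, zero_sub, Preadditive.comp_sum]
      have h4 : ∀ p ∈ antidiagonal s, c' ≫ (X ^ p.1 : End P) ≫ (d ≫ c) ≫ (Y ^ p.2 : End Q) =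
          if p.1 = M then -(c ≫ (Y ^ p.2 : End Q)) else 0 := by
        intro p hp
        rw [mem_antidiagonal] at hp
        have := H.cup_dot_cap p.1 (by omega)
        rw [Category.assoc, ← Category.assoc (X ^ p.1 : End P), ← Category.assoc c', this]
        rcases eq_or_ne p.1 M with h | h
        · rw [if_pos (by omega), if_pos h, Preadditive.neg_comp, Category.id_comp]
        · rw [if_neg (by omega), if_neg h, Limits.zero_comp]
      rw [Finset.sum_congr rfl h4]
      rcases eq_or_ne (s + 1) (M + 1) with h | h
      · obtain rfl : s = M := by omega
        rw [if_pos rfl, Finset.sum_eq_single (s, 0)]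
        · simp [End.one_def]
        · rintro ⟨a, b⟩ hp hne
          rw [mem_antidiagonal] at hp
          refine if_neg fun hh => hne ?_
          simp only at hp hh
          ext <;> simp <;> omega
        · intro hh
          simp at hh
      · rw [if_neg h, Finset.sum_eq_zero, neg_zero]
        intro p hp
        rw [mem_antidiagonal] at hp
        exact if_neg (by omega)
  have h3 : ∀ r ∈ range (M + 1), (c' ≫ (X ^ (r + s) : End P) ≫ d) ≫ cup r =
      if M ≤ r + s then coeffHom (r + s - M) B ≫ (-cup r) else 0 := by
    intro r _
    split_ifs with h
    · rw [hB (r + s - M) (r + s) (by omega), Preadditive.neg_comp_neg]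
    · rw [H.cup_dot_cap _ (by omega), if_neg (by omega), Limits.zero_comp]
  have h4 : ∑ r ∈ range (M + 1), (if M ≤ r + s then coeffHom (r + s - M) B ≫ (-cup r) else 0) =
      ∑ p ∈ antidiagonal s, if p.2 < M + 1 then coeffHom p.1 B ≫ (-cup (M - p.2)) else 0 := by
    rw [← Finset.sum_filter, ← Finset.sum_filter]
    refine Finset.sum_nbij' (fun r => (r + s - M, M - r)) (fun p => M - p.2) ?_ ?_ ?_ ?_ ?_
    · intro r
      simp only [Finset.mem_filter, Finset.mem_range, mem_antidiagonal]
      omega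
    · intro p
      simp only [Finset.mem_filter, Finset.mem_range, mem_antidiagonal]
      omega
    · intro r
      simp only [Finset.mem_filter, Finset.mem_range]
      omega
    · rintro ⟨a, b⟩
      simp only [Finset.mem_filter, mem_antidiagonal, Prod.mk.injEq]
      omega
    · intro r
      simp only [Finset.mem_filter, Finset.mem_range]
      intro hr
      rw [show M - (M - r) = r by omega]
  have h5 : ∀ p ∈ antidiagonal s,
      coeffHom p.1 B ≫ (if p.2 < M + 1 then -cup (M + 1 - 1 - p.2) else c ≫ t') =
      (if p = (0, M + 1) then c ≫ t' else 0) +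
        if p.2 < M + 1 then coeffHom p.1 B ≫ (-cup (M - p.2)) else 0 := by
    rintro ⟨a, b⟩ hp
    rw [mem_antidiagonal] at hp
    simp only at hp
    rcases Nat.lt_or_ge b (M + 1) with h | h
    · rw [if_pos h, if_pos h, if_neg (by simp; omega), zero_add, Nat.add_sub_cancel]
    · obtain rfl : a = 0 := by omega
      obtain rfl : b = M + 1 := by omega
      rw [if_neg h.not_gt, if_neg h.not_gt, if_pos rfl, hB0, Category.id_comp, add_zero]
  rw [h1, h2, Finset.sum_congr rfl h3, h4, Finset.sum_congr rfl h5, Finset.sum_add_distrib]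
  congr 1
  rw [Finset.sum_ite_eq']
  by_cases h : s = M + 1
  · rw [if_pos h, if_pos (by simp [h])]
  · rw [if_neg h, if_neg (by simp [Ne.symm h]), Limits.zero_comp]

include hAB

/-- The last entry, of index `N`, of the inverted Toeplitz system; the entries below it give the
decorated cups. -/
theorem cup_inv_eq_sum :
    c ≫ t' = ∑ p ∈ antidiagonal N, coeffHom p.1 A ≫ c' ≫ (X ^ p.2 : End P) := by
  have h := eq_conv_of_eq_conv_comp hAB (v := fun s => c' ≫ (X ^ s : End P))
    (w := fun q => if q < N then -cup (N - 1 - q) else c ≫ t')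
        (H.leftCup_dot_eq_sum hB0 hB) N le_rfl
  rwa [if_neg (lt_irrefl N)] at h

theorem neg_cup_eq_sum (r : ℕ) (hr : r < N) :
    -cup r = ∑ p ∈ antidiagonal (N - 1 - r), coeffHom p.1 A ≫ c' ≫ (X ^ p.2 : End P) := by
  have h := eq_conv_of_eq_conv_comp hAB (v := fun s => c' ≫ (X ^ s : End P))
    (w := fun q => if q < N then -cup (N - 1 - q) else c ≫ t') (H.leftCup_dot_eq_sum hB0 hB)
        (N - 1 - r) (by omega)
  rwa [if_pos (by omega), show N - 1 - (N - 1 - r) = r by omega] at h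

/-- Both sides obey the same recursion: sliding the dots through `t'` produces products of shorter
counterclockwise bubbles with clockwise ones, which are the lower terms of `A * B = 1`. -/
theorem ccwBubble_eq (m : ℕ) : c ≫ (Y ^ m : End Q) ≫ d' = coeffHom (m + N + 1) A := by
  induction m using Nat.strong_induction_on with
  | _ m ih =>
  have h1 : c ≫ t' ≫ (X ^ (m + N) : End P) ≫ d =
      -∑ p ∈ antidiagonal N, coeffHom p.1 A ≫ coeffHom (p.2 + m + 1) B := by
    rw [← Category.assoc, H.cup_inv_eq_sum hAB hB0 hB, Preadditive.sum_comp,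
      ← Finset.sum_neg_distrib]
    refine Finset.sum_congr rfl fun p _ => ?_
    rw [hB (p.2 + m + 1) (m + N + p.2) (by omega), Preadditive.comp_neg, neg_neg, pow_add X _ p.2,
      End.mul_def]
    simp only [Category.assoc]
  -- In degree m + N + 1 of `A * B = 1`, the terms with first index at most `N` sum to minus the
  -- left side of `h1`; the other terms contain the coefficient sought.
  have h2 := sum_coeffHom_comp hAB (m + N)
  rw [Finset.Nat.sum_antidiagonal_add_add_one (fun a b => coeffHom a A ≫ coeffHom b B),
    add_eq_zero_iff_neg_eq, ← h1] at h2
  rcases m with _ | m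
  · rw [Finset.Nat.antidiagonal_zero, Finset.sum_singleton, hB0, Category.comp_id] at h2
    rw [← h2, H.cap_eq, pow_zero, End.one_def, Category.id_comp, zero_add]
  · rw [Finset.Nat.sum_antidiagonal_succ', hB0, Category.comp_id] at h2
    rw [← sub_eq_iff_eq_add.mpr h2]
    have h3 := comp_pow_of_comp_eq (t := t') (X := Y) (Y := X) (g := -(d' ≫ c'))
      (by rw [H.slide_inv, add_neg_cancel_right]) m
    rw [← sub_eq_iff_eq_add] at h3
    conv_lhs => rw [H.cap_eq]
    rw [← Category.assoc (Y ^ _ : End Q), ← h3, Preadditive.sub_comp, Preadditive.comp_sub]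
    congr 1
    · have hX : (X ^ (m + 1 + N) : End P) = (X ^ (m + 1) : End P) ≫ (X ^ N : End P) := by
        rw [add_comm (m + 1) N, pow_add X N, End.mul_def]
      rw [hX]
      simp only [Category.assoc]
    · rw [Preadditive.sum_comp, Preadditive.comp_sum]
      refine Finset.sum_congr rfl fun p hp => ?_
      rw [mem_antidiagonal] at hp
      rw [hB (p.2 + 1) (N + p.2) (by omega), ← ih p.1 (by omega), pow_add, End.mul_def]
      simp only [Preadditive.neg_comp, Preadditive.comp_neg, Category.assoc]

/-- Expand `d'` and replace `t ≫ t'` by the identity minus its defect. The scalar obtained by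
closing `cup r` with `N` dots is then minus the coefficient of `A` in degree N - r. -/
theorem comp_leftCap :
    t ≫ d' = ∑ p ∈ antidiagonal N, ((X ^ p.1 : End P) ≫ d) ≫ coeffHom p.2 A := by
  have h1 : t ≫ t' = 𝟙 P - ∑ r ∈ range N, ((X ^ r : End P) ≫ d) ≫ cup r := by
    rw [← H.comp_inv, add_sub_cancel_right]
  rw [H.cap_eq, ← Category.assoc, h1, Preadditive.sub_comp, Category.id_comp,
    Finset.Nat.sum_antidiagonal_eq_sum_range_succ
      (fun a b => ((X ^ a : End P) ≫ d) ≫ coeffHom b A), Finset.sum_range_succ, Nat.sub_self,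
    coeffHom_zero_eq hAB hB0, Category.comp_id, add_comm, sub_eq_add_neg, Preadditive.sum_comp,
    ← Finset.sum_neg_distrib]
  congr 1
  refine Finset.sum_congr rfl fun r hr => ?_
  rw [Finset.mem_range] at hr
  obtain ⟨n, hn⟩ : ∃ n, N = n + 1 + r := ⟨N - r - 1, by omega⟩
  rw [show N - r = n + 1 by omega, coeffHom_succ_eq hAB hB0, Category.assoc,
    ← Preadditive.comp_neg, ← Preadditive.neg_comp, H.neg_cup_eq_sum hAB hB0 hB r hr,
    show N - 1 - r = n by omega, Preadditive.sum_comp, ← Finset.sum_neg_distrib]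
  congr 1
  refine Finset.sum_congr rfl fun p _ => ?_
  rw [hB (p.2 + 1) (N + p.2) (by omega), pow_add, End.mul_def]
  simp only [Preadditive.comp_neg, neg_neg, Category.assoc]

end ColumnInversion

end CategoryTheory

/-! ### The inversion relation for a row. -/

namespace CategoryTheory

open Finset (range)
open Finset.HasAntidiagonal (antidiagonal mem_antidiagonal)

variable {C : Type*} [Category C] [Preadditive C] [MonoidalCategory C] {P Q : C}

/-- A two-sided inverse `[t', cap 0, …, cap M]` of the row with entries `t`, `c` and its
composites with powers of `Y`, together with the leftward cup `c'` and cap `d'`. -/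
structure RowInversion (M : ℕ) (t : P ⟶ Q) (t' : Q ⟶ P) (X : End P) (Y : End Q)
    (c : 𝟙_ C ⟶ Q) (d : P ⟶ 𝟙_ C) (cap : ℕ → (Q ⟶ 𝟙_ C)) (c' : 𝟙_ C ⟶ P) (d' : Q ⟶ 𝟙_ C) :
    Prop where
  slide : t ≫ Y = X ≫ t + d ≫ c
  comp_inv : t ≫ t' = 𝟙 P
  inv_comp : t' ≫ t + ∑ r ∈ range (M + 1), cap r ≫ c ≫ (Y ^ r : End Q) = 𝟙 Q
  comp_cap (r : ℕ) : r ≤ M → t ≫ cap r = 0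
  cup_inv (r : ℕ) : r ≤ M → c ≫ (Y ^ r : End Q) ≫ t' = 0
  cup_cap (r s : ℕ) : r ≤ M → s ≤ M → c ≫ (Y ^ r : End Q) ≫ cap s =
    if r = s then 𝟙 (𝟙_ C) else 0
  cap_eq : d' = cap M
  cup_eq : c' = c ≫ (Y ^ (M + 1) : End Q) ≫ t'

namespace RowInversion

variable {M : ℕ} {t : P ⟶ Q} {t' : Q ⟶ P} {X : End P} {Y : End Q}
    {c : 𝟙_ C ⟶ Q} {d : P ⟶ 𝟙_ C} {cap : ℕ → (Q ⟶ 𝟙_ C)} {c' : 𝟙_ C ⟶ P} {d' : Q ⟶ 𝟙_ C}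
    (H : RowInversion M t t' X Y c d cap c' d')
include H

theorem cup_dot_cap (s : ℕ) (hs : s ≤ M) :
    c ≫ (Y ^ s : End Q) ≫ d' = if s = M then 𝟙 (𝟙_ C) else 0 := by
  rw [H.cap_eq, H.cup_cap s M hs le_rfl]

theorem comp_leftCap : t ≫ d' = 0 := by
  rw [H.cap_eq, H.comp_cap M le_rfl]

theorem inv_comp_eq :
    t' ≫ t = 𝟙 Q - ∑ r ∈ range (M + 1), cap r ≫ c ≫ (Y ^ r : End Q) := by
  rw [← H.inv_comp, add_sub_cancel_right]

/-- Here the defect lies in `t' ≫ t`. After one more dot, every dotted cup except the top one is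
killed by `t'`, and the surviving term is `cap M` followed by `c'`. -/
theorem slide_inv : Y ≫ t' = t' ≫ X + d' ≫ c' := by
  have h : t' ≫ (t ≫ Y) ≫ t' = t' ≫ X := by
    rw [H.slide, Preadditive.add_comp, Preadditive.comp_add, Category.assoc, Category.assoc,
      H.comp_inv, Category.comp_id]
    have h2 : c ≫ t' = 0 := by
      have := H.cup_inv 0 (Nat.zero_le _)
      rwa [pow_zero, End.one_def, Category.id_comp] at this
    rw [h2, Limits.comp_zero, Limits.comp_zero, add_zero]
  have h3 : ∀ r, (Y ^ r : End Q) ≫ Y ≫ t' = (Y ^ (r + 1) : End Q) ≫ t' := fun r => by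
    rw [pow_succ', End.mul_def, Category.assoc]
  rw [← h, Category.assoc, ← Category.assoc t', H.inv_comp_eq, Preadditive.sub_comp,
    Category.id_comp, Preadditive.sum_comp, Finset.sum_range_succ, Finset.sum_eq_zero, zero_add,
    Category.assoc, Category.assoc, h3, ← H.cup_eq, ← H.cap_eq, sub_add_cancel]
  intro r hr
  rw [Finset.mem_range] at hr
  rw [Category.assoc, Category.assoc, h3, H.cup_inv _ (by omega), Limits.comp_zero]

variable {A B : PowerSeries (End (𝟙_ C))} (hBA : B * A = 1) (hA0 : coeffHom 0 A = 𝟙 (𝟙_ C))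
  (hA : ∀ i m, i + M = m → coeffHom i A = c ≫ (Y ^ m : End Q) ≫ d')
include hA0 hA

/-- The counterpart of the column case for caps: inserting the resolution of `𝟙 Q` gives
counterclockwise bubbles, the coefficients of `A`, acting on the reversed list of caps completed by
`t' ≫ d`. -/
theorem dot_leftCap_eq_sum (s : ℕ) (hs : s ≤ M + 1) : (Y ^ s : End Q) ≫ d' =
    ∑ p ∈ antidiagonal s, (if p.2 < M + 1 then cap (M - p.2) else t' ≫ d) ≫ coeffHom p.1 A := by
  have h1 : (Y ^ s : End Q) ≫ d' = t' ≫ (t ≫ (Y ^ s : End Q) ≫ d') +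
      ∑ r ∈ range (M + 1), cap r ≫ c ≫ (Y ^ (r + s) : End Q) ≫ d' := by
    conv_lhs => rw [← Category.id_comp (Y ^ s : End Q), ← H.inv_comp]
    simp only [Preadditive.add_comp, Preadditive.sum_comp, Category.assoc, add_comm _ s, pow_add,
      End.mul_def]
  have h2 : t ≫ (Y ^ s : End Q) ≫ d' = if s = M + 1 then d else 0 := by
    rcases s with _ | s
    · rw [pow_zero, End.one_def, Category.id_comp, H.comp_leftCap, if_neg (by omega)]
    · rw [← Category.assoc, comp_pow_of_comp_eq H.slide s, Preadditive.add_comp, Category.assoc,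
        H.comp_leftCap, Limits.comp_zero, zero_add, Preadditive.sum_comp]
      have h4 : ∀ p ∈ antidiagonal s, ((X ^ p.1 : End P) ≫ (d ≫ c) ≫ (Y ^ p.2 : End Q)) ≫ d' =
          if p.2 = M then (X ^ p.1 : End P) ≫ d else 0 := by
        intro p hp
        rw [mem_antidiagonal] at hp
        have := H.cup_dot_cap p.2 (by omega)
        simp only [Category.assoc]
        rw [this]
        split_ifs with h
        · rw [Category.comp_id]
        · rw [Limits.comp_zero, Limits.comp_zero]
      rw [Finset.sum_congr rfl h4]
      rcases eq_or_ne (s + 1) (M + 1) with h | h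
      · obtain rfl : s = M := by omega
        rw [if_pos rfl, Finset.sum_eq_single (0, s)]
        · simp [End.one_def]
        · rintro ⟨a, b⟩ hp hne
          rw [mem_antidiagonal] at hp
          refine if_neg fun hh => hne ?_
          simp only at hp hh
          ext <;> simp <;> omega
        · intro hh
          simp at hh
      · rw [if_neg h, Finset.sum_eq_zero]
        intro p hp
        rw [mem_antidiagonal] at hp
        exact if_neg (by omega)
  have h3 : ∀ r ∈ range (M + 1), cap r ≫ c ≫ (Y ^ (r + s) : End Q) ≫ d' =
      if M ≤ r + s then cap r ≫ coeffHom (r + s - M) A else 0 := by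
    intro r _
    split_ifs with h
    · rw [hA (r + s - M) (r + s) (by omega)]
    · rw [H.cup_dot_cap _ (by omega), if_neg (by omega), Limits.comp_zero]
  have h4 : ∑ r ∈ range (M + 1), (if M ≤ r + s then cap r ≫ coeffHom (r + s - M) A else 0) =
      ∑ p ∈ antidiagonal s, if p.2 < M + 1 then cap (M - p.2) ≫ coeffHom p.1 A else 0 := by
    rw [← Finset.sum_filter, ← Finset.sum_filter]
    refine Finset.sum_nbij' (fun r => (r + s - M, M - r)) (fun p => M - p.2) ?_ ?_ ?_ ?_ ?_
    · intro r
      simp only [Finset.mem_filter, Finset.mem_range, mem_antidiagonal]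
      omega
    · intro p
      simp only [Finset.mem_filter, Finset.mem_range, mem_antidiagonal]
      omega
    · intro r
      simp only [Finset.mem_filter, Finset.mem_range]
      omega
    · rintro ⟨a, b⟩
      simp only [Finset.mem_filter, mem_antidiagonal, Prod.mk.injEq]
      omega
    · intro r
      simp only [Finset.mem_filter, Finset.mem_range]
      intro hr
      rw [show M - (M - r) = r by omega]
  have h5 : ∀ p ∈ antidiagonal s,
      (if p.2 < M + 1 then cap (M - p.2) else t' ≫ d) ≫ coeffHom p.1 A =
      (if p = (0, M + 1) then t' ≫ d else 0) +
        if p.2 < M + 1 then cap (M - p.2) ≫ coeffHom p.1 A else 0 := by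
    rintro ⟨a, b⟩ hp
    rw [mem_antidiagonal] at hp
    simp only at hp
    rcases Nat.lt_or_ge b (M + 1) with h | h
    · rw [if_pos h, if_pos h, if_neg (by simp; omega), zero_add]
    · obtain rfl : a = 0 := by omega
      obtain rfl : b = M + 1 := by omega
      rw [if_neg h.not_gt, if_neg h.not_gt, if_pos rfl, hA0, Category.comp_id, add_zero]
  rw [h1, h2, Finset.sum_congr rfl h3, h4, Finset.sum_congr rfl h5, Finset.sum_add_distrib]
  congr 1
  rw [Finset.sum_ite_eq']
  by_cases h : s = M + 1
  · rw [if_pos h, if_pos (by simp [h])]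
  · rw [if_neg h, if_neg (by simp [Ne.symm h]), Limits.comp_zero]

include hBA

theorem inv_cap_eq_sum :
    t' ≫ d = ∑ p ∈ antidiagonal (M + 1), ((Y ^ p.2 : End Q) ≫ d') ≫ coeffHom p.1 B := by
  have h := eq_conv_of_eq_comp_conv hBA (v := fun s => (Y ^ s : End Q) ≫ d')
    (w := fun q => if q < M + 1 then cap (M - q) else t' ≫ d) (H.dot_leftCap_eq_sum hA0 hA)
    (M + 1) le_rfl
  rwa [if_neg (lt_irrefl _)] at h

theorem cap_eq_sum (r : ℕ) (hr : r ≤ M) :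
    cap r = ∑ p ∈ antidiagonal (M - r), ((Y ^ p.2 : End Q) ≫ d') ≫ coeffHom p.1 B := by
  have h := eq_conv_of_eq_comp_conv hBA (v := fun s => (Y ^ s : End Q) ≫ d')
    (w := fun q => if q < M + 1 then cap (M - q) else t' ≫ d) (H.dot_leftCap_eq_sum hA0 hA)
    (M - r) (by omega)
  rwa [if_pos (by omega), show M - (M - r) = r by omega] at h

/-- Now `A` holds the given bubbles and `B` its inverse. Since `c'` contains `t'`, the dots are
moved back through `t'`; the correction terms are products of counterclockwise bubbles and shorter
clockwise ones, as in the recursion from `B * A = 1`. -/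
theorem neg_cwBubble_eq (m : ℕ) :
    -(c' ≫ (X ^ m : End P) ≫ d) = coeffHom (m + (M + 1) + 1) B := by
  induction m using Nat.strong_induction_on with
  | _ m ih =>
  have h1 : c ≫ (Y ^ (m + (M + 1)) : End Q) ≫ t' ≫ d =
      ∑ p ∈ antidiagonal (M + 1), coeffHom p.1 B ≫ coeffHom (p.2 + m + 1) A := by
    rw [H.inv_cap_eq_sum hBA hA0 hA, Preadditive.comp_sum, Preadditive.comp_sum]
    refine Finset.sum_congr rfl fun p _ => ?_
    rw [endUnit_comp_comm, hA (p.2 + m + 1) (p.2 + (m + (M + 1))) (by omega), pow_add Y p.2,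
      End.mul_def]
    simp only [Category.assoc]
  have h2 := sum_coeffHom_comp hBA (m + (M + 1))
  rw [Finset.Nat.sum_antidiagonal_add_add_one (fun a b => coeffHom a B ≫ coeffHom b A),
    ← h1, add_eq_zero_iff_neg_eq] at h2
  rcases m with _ | m
  · rw [Finset.Nat.antidiagonal_zero, Finset.sum_singleton, hA0, Category.comp_id] at h2
    rw [← h2, H.cup_eq, pow_zero, End.one_def, Category.id_comp, zero_add]
    simp only [Category.assoc]
  · rw [Finset.Nat.sum_antidiagonal_succ', hA0, Category.comp_id] at h2
    rw [← sub_eq_iff_eq_add.mpr h2]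
    have h3 := comp_pow_of_comp_eq (t := t') (X := Y) (Y := X) (g := -(d' ≫ c'))
      (by rw [H.slide_inv, add_neg_cancel_right]) m
    have hY : (Y ^ (m + 1 + (M + 1)) : End Q) =
        (Y ^ (M + 1) : End Q) ≫ (Y ^ (m + 1) : End Q) := by
      rw [pow_add Y (m + 1), End.mul_def]
    have h4 : c' ≫ (X ^ (m + 1) : End P) ≫ d =
        c ≫ (Y ^ (M + 1) : End Q) ≫ (t' ≫ (X ^ (m + 1) : End P)) ≫ d := by
      rw [H.cup_eq]
      simp only [Category.assoc]
    rw [h4, h3, Preadditive.add_comp, Preadditive.comp_add, Preadditive.comp_add, neg_add,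
      sub_eq_add_neg]
    congr 1
    · rw [hY]
      simp only [Category.assoc]
    · congr 1
      rw [Preadditive.sum_comp, Preadditive.comp_sum, Preadditive.comp_sum]
      -- The correction terms carry the counterclockwise factor first and the recursion carries it
      -- second.
      rw [← Finset.Nat.sum_antidiagonal_swap]
      refine Finset.sum_congr rfl fun p hp => ?_
      rw [mem_antidiagonal] at hp
      rw [Prod.fst_swap, Prod.snd_swap, endUnit_comp_comm, ← ih p.1 (by omega),
        hA (p.2 + 1) (p.2 + (M + 1)) (by omega), pow_add Y p.2, End.mul_def]
      simp only [Preadditive.neg_comp, Preadditive.comp_neg, Category.assoc]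

/-- Replace `t' ≫ t` by the identity minus its defect; the scalar obtained by closing `M + 1` dots
with `cap r` is minus the coefficient of `B` in degree M + 1 - r. -/
theorem leftCup_comp :
    c' ≫ t = ∑ p ∈ antidiagonal (M + 1), coeffHom p.2 B ≫ c ≫ (Y ^ p.1 : End Q) := by
  rw [H.cup_eq, Category.assoc, Category.assoc, H.inv_comp_eq, Preadditive.comp_sub,
    Preadditive.comp_sub, Category.comp_id,
    Finset.Nat.sum_antidiagonal_eq_sum_range_succ
      (fun a b => coeffHom b B ≫ c ≫ (Y ^ a : End Q)), Finset.sum_range_succ _ (M + 1),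
          Nat.sub_self,
    coeffHom_zero_eq hBA hA0, Category.id_comp, add_comm (Finset.sum _ _), sub_eq_add_neg,
        Preadditive.comp_sum,
    Preadditive.comp_sum, ← Finset.sum_neg_distrib]
  congr 1
  refine Finset.sum_congr rfl fun r hr => ?_
  rw [Finset.mem_range] at hr
  obtain ⟨n, hn⟩ : ∃ n, M = n + r := ⟨M - r, by omega⟩
  rw [show M + 1 - r = n + 1 by omega, coeffHom_succ_eq hBA hA0,
      H.cap_eq_sum hBA hA0 hA r (by omega),
    show M - r = n by omega, Preadditive.neg_comp, Preadditive.sum_comp, Preadditive.sum_comp,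
    Preadditive.comp_sum, Preadditive.comp_sum]
  refine congrArg Neg.neg (Finset.sum_congr rfl fun p _ => ?_)
  rw [endUnit_comp_comm, hA (p.2 + 1) (p.2 + (M + 1)) (by omega), pow_add Y p.2, End.mul_def]
  simp only [Category.assoc]

end RowInversion

end CategoryTheory

/-! ### Rotation of strands along a dual pairing, and dot slides for the rotated crossing. -/

namespace CategoryTheory

variable {C : Type*} [Category C] [MonoidalCategory C]

theorem whiskerRight_pow {U : C} (x : End U) (D : C) (n : ℕ) :
    (x ^ n : End U) ▷ D = ((show End (U ⊗ D) from x ▷ D) ^ n : End (U ⊗ D)) := by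
  induction n with
  | zero => exact id_whiskerRight U D
  | succ n ih => rw [pow_succ, pow_succ, End.mul_def, End.mul_def, comp_whiskerRight, ih]

theorem whiskerLeft_pow {U : C} (x : End U) (D : C) (n : ℕ) :
    D ◁ (x ^ n : End U) = ((show End (D ⊗ U) from D ◁ x) ^ n : End (D ⊗ U)) := by
  induction n with
  | zero => exact whiskerLeft_id D U
  | succ n ih => rw [pow_succ, pow_succ, End.mul_def, End.mul_def, whiskerLeft_comp, ih]

section Mates

/-- the left dual of an object -/
local postfix:max "ᵛ" => HasLeftDual.leftDual

variable {U : C} [HasLeftDual U]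

/-- The endomorphism of the left dual `Uᵛ` attached to a pairing of `U` with `Uᵛ`. -/
def mate (g : U ⊗ Uᵛ ⟶ 𝟙_ C) : End Uᵛ :=
  tensorLeftHomEquiv Uᵛ Uᵛ U (𝟙_ C) g ≫ (ρ_ Uᵛ).hom

/-- The endomorphism of `U` attached to a copairing of the left dual `Uᵛ` with `U`. -/
def comate (h : 𝟙_ C ⟶ Uᵛ ⊗ U) : End U :=
  (ρ_ U).inv ≫ (tensorLeftHomEquiv (𝟙_ C) Uᵛ U U).symm h

theorem mate_def (g : U ⊗ Uᵛ ⟶ 𝟙_ C) : mate g =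
    (λ_ Uᵛ).inv ≫ η_ Uᵛ U ▷ Uᵛ ≫ (α_ Uᵛ U Uᵛ).hom ≫ Uᵛ ◁ g ≫ (ρ_ Uᵛ).hom := by
  simp [mate, tensorLeftHomEquiv]

theorem comate_def (h : 𝟙_ C ⟶ Uᵛ ⊗ U) : comate h =
    (ρ_ U).inv ≫ U ◁ h ≫ (α_ U Uᵛ U).inv ≫ ε_ Uᵛ U ▷ U ≫ (λ_ U).hom := by
  simp [comate, tensorLeftHomEquiv]

theorem mate_whiskerLeft_comp_evaluation (y : End Uᵛ) : mate (U ◁ y ≫ ε_ Uᵛ U) = y := by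
  rw [mate, tensorLeftHomEquiv_whiskerLeft_comp_evaluation, Category.assoc, Iso.inv_hom_id,
    Category.comp_id]

theorem mate_whiskerRight_comp_evaluation (x : End U) :
    mate (x ▷ Uᵛ ≫ ε_ Uᵛ U) = leftAdjointMate x := by
  rw [mate, tensorLeftHomEquiv_whiskerRight_comp_evaluation, Category.assoc, Iso.inv_hom_id,
    Category.comp_id]

theorem comate_coevaluation_comp_whiskerLeft (y : End U) :
    comate (η_ Uᵛ U ≫ Uᵛ ◁ y) = y := by
  simp [comate]

/-- The rightward crossing obtained from an upward crossing by rotation. -/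
def rightCrossing (s : U ⊗ U ⟶ U ⊗ U) : U ⊗ Uᵛ ⟶ Uᵛ ⊗ U :=
  tensorLeftHomEquiv (U ⊗ Uᵛ) Uᵛ U U
    ((α_ U U Uᵛ).inv ≫ s ▷ Uᵛ ≫ (α_ U U Uᵛ).hom ≫ U ◁ ε_ Uᵛ U ≫ (ρ_ U).hom)

theorem rightCrossing_def (s : U ⊗ U ⟶ U ⊗ U) : rightCrossing s =
    (λ_ _).inv ≫ η_ Uᵛ U ▷ (U ⊗ Uᵛ) ≫ (α_ Uᵛ U (U ⊗ Uᵛ)).hom ≫ Uᵛ ◁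
      ((α_ U U Uᵛ).inv ≫ s ▷ Uᵛ ≫ (α_ U U Uᵛ).hom ≫ U ◁ ε_ Uᵛ U ≫ (ρ_ U).hom) := rfl

theorem tensorLeftHomEquiv_whiskerLeft_comp {X X' Z : C} (f : X ⟶ X') (g : U ⊗ X' ⟶ Z) :
    tensorLeftHomEquiv X Uᵛ U Z (U ◁ f ≫ g) = f ≫ tensorLeftHomEquiv X' Uᵛ U Z g := by
  rw [← Equiv.eq_symm_apply, tensorLeftHomEquiv_symm_naturality, Equiv.symm_apply_apply]

/-- A dot on the strand being bent travels around the cup and reappears as its mate on the dual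
strand. -/
theorem tensorLeftHomEquiv_whiskerRight_comp {X Z : C} (x : End U) (g : U ⊗ X ⟶ Z) :
    tensorLeftHomEquiv X Uᵛ U Z (x ▷ X ≫ g) =
      tensorLeftHomEquiv X Uᵛ U (U ⊗ X) (𝟙 _) ≫ (leftAdjointMate x) ▷ (U ⊗ X) ≫ Uᵛ ◁ g := by
  change (λ_ X).inv ≫ η_ Uᵛ U ▷ X ≫ (α_ Uᵛ U X).hom ≫ Uᵛ ◁ (x ▷ X ≫ g) =
    ((λ_ X).inv ≫ η_ Uᵛ U ▷ X ≫ (α_ Uᵛ U X).hom ≫ Uᵛ ◁ 𝟙 _) ≫ _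
  have h := congrArg (· ▷ X) (coevaluation_comp_leftAdjointMate x)
  simp only [comp_whiskerRight] at h
  rw [whiskerLeft_comp, ← associator_naturality_middle_assoc, ← reassoc_of% h]
  simp

/-- This is where the cap-cup term of the rotated dot slides comes from: it is the rotation of the
identity in the upward relation. -/
theorem tensorLeftHomEquiv_whiskerLeft_evaluation :
    tensorLeftHomEquiv (U ⊗ Uᵛ) Uᵛ U U (U ◁ ε_ Uᵛ U ≫ (ρ_ U).hom) =
      ε_ Uᵛ U ≫ η_ Uᵛ U := by
  rw [tensorLeftHomEquiv_whiskerLeft_comp, ← Category.comp_id (ρ_ U).hom,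
    ← tensorLeftHomEquiv_symm_coevaluation_comp_whiskerLeft (Y := Uᵛ), Equiv.apply_symm_apply,
    whiskerLeft_id, Category.comp_id]

variable [Preadditive C] [MonoidalPreadditive C]

theorem tensorLeftHomEquiv_add (X Z : C) (f g : U ⊗ X ⟶ Z) :
    tensorLeftHomEquiv X Uᵛ U Z (f + g) =
      tensorLeftHomEquiv X Uᵛ U Z f + tensorLeftHomEquiv X Uᵛ U Z g := by
  simp [tensorLeftHomEquiv]

variable {s : U ⊗ U ⟶ U ⊗ U} {x : End U}

theorem rightCrossing_comp_dot (h : s ≫ x ▷ U = U ◁ x ≫ s + 𝟙 (U ⊗ U)) :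
    rightCrossing s ≫ Uᵛ ◁ x = x ▷ Uᵛ ≫ rightCrossing s + ε_ Uᵛ U ≫ η_ Uᵛ U := by
  rw [rightCrossing, ← tensorLeftHomEquiv_naturality, ← tensorLeftHomEquiv_whiskerLeft_evaluation,
    ← tensorLeftHomEquiv_whiskerLeft_comp, ← tensorLeftHomEquiv_add]
  congr 1
  have h' := congrArg (· ▷ Uᵛ) h
  simp only [comp_whiskerRight, MonoidalPreadditive.add_whiskerRight, id_whiskerRight] at h'
  have e : (U ◁ ε_ Uᵛ U ≫ (ρ_ U).hom) ≫ x =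
      x ▷ (U ⊗ Uᵛ) ≫ U ◁ ε_ Uᵛ U ≫ (ρ_ U).hom := by
    rw [Category.assoc, ← rightUnitor_naturality, whisker_exchange_assoc]
  simp only [Category.assoc] at e ⊢
  rw [e, ← associator_naturality_left_assoc, reassoc_of% h', Preadditive.add_comp,
    Preadditive.comp_add, Category.id_comp, Category.assoc, Iso.inv_hom_id_assoc,
    associator_inv_naturality_middle_assoc]

/-- The dot on the other upward strand is needed here. Conjugating by the involution `s` turns the
given slide into one for that strand, and rotation then carries its dots around both bends. -/
theorem dualDot_comp_rightCrossing (h : s ≫ x ▷ U = U ◁ x ≫ s + 𝟙 (U ⊗ U))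
    (hs : s ≫ s = 𝟙 (U ⊗ U)) :
    rightCrossing s ≫ (leftAdjointMate x) ▷ U =
        U ◁ (leftAdjointMate x) ≫ rightCrossing s + ε_ Uᵛ U ≫ η_ Uᵛ U := by
  have h1 : x ▷ U ≫ s = s ≫ U ◁ x + 𝟙 (U ⊗ U) := by
    have := congrArg (fun f => s ≫ f ≫ s) h
    simp only [Preadditive.add_comp, Preadditive.comp_add, Category.assoc, hs, Category.comp_id,
      Category.id_comp] at this
    rwa [reassoc_of% hs] at this
  have h' := congrArg (· ▷ Uᵛ) h1
  simp only [comp_whiskerRight, MonoidalPreadditive.add_whiskerRight, id_whiskerRight] at h'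
  have h2 : rightCrossing s ≫ (leftAdjointMate x) ▷ U = tensorLeftHomEquiv (U ⊗ Uᵛ) Uᵛ
      U U (x ▷ (U ⊗ Uᵛ) ≫
      (α_ U U Uᵛ).inv ≫ s ▷ Uᵛ ≫ (α_ U U Uᵛ).hom ≫ U ◁ ε_ Uᵛ U ≫ (ρ_ U).hom) := by
    rw [tensorLeftHomEquiv_whiskerRight_comp, ← whisker_exchange, ← Category.assoc,
      ← tensorLeftHomEquiv_naturality, Category.id_comp, rightCrossing]
  rw [h2, rightCrossing, ← tensorLeftHomEquiv_whiskerLeft_evaluation,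
    ← tensorLeftHomEquiv_whiskerLeft_comp, ← tensorLeftHomEquiv_add]
  congr 1
  have e := congrArg (U ◁ ·) (leftAdjointMate_comp_evaluation x)
  simp only [whiskerLeft_comp] at e
  rw [associator_inv_naturality_left_assoc, reassoc_of% h', Preadditive.add_comp,
    Preadditive.comp_add, Category.id_comp, Category.assoc, Iso.inv_hom_id_assoc,
    associator_naturality_middle_assoc, ← reassoc_of% e, associator_inv_naturality_right_assoc,
    whisker_exchange_assoc, associator_naturality_right_assoc]

end Mates

end CategoryTheory

/-! ### The defining relations of the Heisenberg category as identities of morphisms. -/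

namespace StrictPresentation

variable {k : Type u} [CommRing k] {α : Type} {G : List α → List α → Type}
  {R : ∀ ⦃a b : List α⦄, Term k G a b → Term k G a b → Prop}

theorem ofTerm_pow {a : List α} (f : Term k G a a) (n : ℕ) :
    ofTerm R (f.pow n) = ((show End (⟨a⟩ : Obj R) from ofTerm R f) ^ n : End (⟨a⟩ : Obj R)) := by
  induction n with
  | zero => rfl
  | succ n ih =>
    rw [pow_succ', End.mul_def, ← ih]
    rfl

theorem ofTerm_sum {a b : List α} {n : ℕ} (f : Fin n → Term k G a b) :
    ofTerm R (Term.sum f) = ∑ i, ofTerm R (f i) := by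
  induction n with
  | zero =>
    rw [Fin.sum_univ_zero]
    rfl
  | succ n ih =>
    rw [Fin.sum_univ_succ, ← ih, Term.sum, List.ofFn_succ]
    rfl

end StrictPresentation

namespace Heisenberg

open StrictPresentation Strand

variable (k : Type u) [CommRing k] (κ : ℤ)

theorem adj_up : upObj k κ ◁ c k κ ≫ (α_ (upObj k κ) (downObj k κ) (upObj k κ)).inv ≫
    d k κ ▷ upObj k κ = (ρ_ (upObj k κ)).hom ≫ (λ_ (upObj k κ)).inv := by
  refine (Eq.trans ?_ (Quot.sound (Rel.of (R := Relation k κ) Relation.adj_up))).trans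
    (Quot.sound (Rel.id_comp _)).symm
  exact Quot.sound ((Rel.refl _).comp_congr (Rel.id_comp _))

theorem adj_down : c k κ ▷ downObj k κ ≫ (α_ (downObj k κ) (upObj k κ) (downObj k κ)).hom ≫
    downObj k κ ◁ d k κ = (λ_ (downObj k κ)).hom ≫ (ρ_ (downObj k κ)).inv := by
  refine (Eq.trans ?_ (Quot.sound (Rel.of (R := Relation k κ) Relation.adj_down))).trans
    (Quot.sound (Rel.id_comp _)).symm
  exact Quot.sound ((Rel.refl _).comp_congr (Rel.id_comp _))

instance : ExactPairing (downObj k κ) (upObj k κ) where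
  coevaluation' := c k κ
  evaluation' := d k κ
  coevaluation_evaluation' := adj_up k κ
  evaluation_coevaluation' := adj_down k κ

instance : HasLeftDual (upObj k κ) where
  leftDual := downObj k κ

/-- The upward crossing. -/
def s : upObj k κ ⊗ upObj k κ ⟶ upObj k κ ⊗ upObj k κ := ofTerm (Relation k κ) (.gen .s)

theorem s_comp_s : s k κ ≫ s k κ = 𝟙 (upObj k κ ⊗ upObj k κ) :=
  Quot.sound (Rel.of Relation.s_sq)

theorem s_comp_dot : s k κ ≫ x k κ ▷ upObj k κ =
    upObj k κ ◁ x k κ ≫ s k κ + 𝟙 (upObj k κ ⊗ upObj k κ) :=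
  Quot.sound (Rel.of Relation.dot_slide)

/-- The rightward crossing. -/
def t : upObj k κ ⊗ downObj k κ ⟶ downObj k κ ⊗ upObj k κ := rightCrossing (s k κ)

/-- On these concrete words all associators and unitors are identity terms, so the two expressions
differ only by identity laws, reassociation and interchange. -/
theorem ofTerm_tT : ofTerm (Relation k κ) (tT k κ) = t k κ := by
  refine Eq.trans ?_ (rightCrossing_def (s k κ)).symm
  refine Quot.sound ((Rel.comp_assoc _ _ _).trans ?_)
  refine ((Rel.id_comp _).trans ((Rel.refl _).comp_congr ((Rel.id_comp _).trans ?_))).symm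
  refine ((Rel.refl _).tensor_congr ((Rel.id_comp _).trans ((Rel.refl _).comp_congr
    ((Rel.id_comp _).trans (Rel.comp_id _))))).trans ?_
  refine (((Rel.id_comp _).symm.tensor_congr (Rel.refl _)).trans
    (Rel.tensor_comp_tensor _ _ _ _).symm).trans ((Rel.refl _).comp_congr ?_)
  refine (Rel.tensor_assoc (.id [down]) (.id [up]) (dT k κ)).symm.trans ?_
  exact (Rel.id_tensor_id _ _).tensor_congr (Rel.refl _)

/-- The dot on the upward strand of `↑ ⊗ ↓`. -/
def dotUpDown : End (upObj k κ ⊗ downObj k κ) := x k κ ▷ downObj k κ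

/-- The dot on the upward strand of `↓ ⊗ ↑`. -/
def dotDownUp : End (downObj k κ ⊗ upObj k κ) := downObj k κ ◁ x k κ

theorem dotUpDown_pow (r : ℕ) : (dotUpDown k κ ^ r : End (upObj k κ ⊗ downObj k κ)) =
    (x k κ ^ r : End (upObj k κ)) ▷ downObj k κ :=
  (whiskerRight_pow _ _ _).symm

theorem dotDownUp_pow (r : ℕ) : (dotDownUp k κ ^ r : End (downObj k κ ⊗ upObj k κ)) =
    downObj k κ ◁ (x k κ ^ r : End (upObj k κ)) :=
  (whiskerLeft_pow _ _ _).symm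

theorem x_pow (r : ℕ) :
    (x k κ ^ r : End (upObj k κ)) = ofTerm (Relation k κ) ((xT k κ).pow r) :=
  (ofTerm_pow _ _).symm

theorem ofTerm_dotCapT (r : ℕ) : ofTerm (Relation k κ) (dotCapT k κ r) =
    (dotUpDown k κ ^ r : End (upObj k κ ⊗ downObj k κ)) ≫ d k κ := by
  rw [dotUpDown_pow, x_pow]
  rfl

theorem ofTerm_dotCupT (r : ℕ) : ofTerm (Relation k κ) (dotCupT k κ r) =
    c k κ ≫ (dotDownUp k κ ^ r : End (downObj k κ ⊗ upObj k κ)) := by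
  rw [dotDownUp_pow, x_pow]
  rfl

theorem t_comp_dot : t k κ ≫ dotDownUp k κ = dotUpDown k κ ≫ t k κ + d k κ ≫ c k κ :=
  rightCrossing_comp_dot (s_comp_dot k κ)

theorem x'_eq : x' k κ = leftAdjointMate (x k κ) := by
  refine Eq.trans ?_ (mate_whiskerRight_comp_evaluation (x k κ))
  rw [mate_def]
  rfl

/-- The dot on the downward strand of `↑ ⊗ ↓`. -/
def dualDotUpDown : End (upObj k κ ⊗ downObj k κ) := upObj k κ ◁ x' k κ

/-- The dot on the downward strand of `↓ ⊗ ↑`. -/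
def dualDotDownUp : End (downObj k κ ⊗ upObj k κ) := x' k κ ▷ upObj k κ

theorem dualDotUpDown_pow (r : ℕ) : (dualDotUpDown k κ ^ r : End (upObj k κ ⊗ downObj k κ)) =
    upObj k κ ◁ (x' k κ ^ r : End (downObj k κ)) :=
  (whiskerLeft_pow _ _ _).symm

theorem t_comp_dualDot :
    t k κ ≫ dualDotDownUp k κ = dualDotUpDown k κ ≫ t k κ + d k κ ≫ c k κ := by
  rw [dualDotDownUp, dualDotUpDown, x'_eq]
  exact dualDot_comp_rightCrossing (s_comp_dot k κ) (s_comp_s k κ)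

theorem dualDot_comp_d : dualDotUpDown k κ ≫ d k κ = dotUpDown k κ ≫ d k κ := by
  rw [dualDotUpDown, x'_eq]
  exact leftAdjointMate_comp_evaluation (x k κ)

theorem c_comp_dualDot : c k κ ≫ dualDotDownUp k κ = c k κ ≫ dotDownUp k κ := by
  rw [dualDotDownUp, x'_eq]
  exact coevaluation_comp_leftAdjointMate (x k κ)

theorem dotUpDown_comm : dotUpDown k κ ≫ dualDotUpDown k κ = dualDotUpDown k κ ≫ dotUpDown k κ :=
  (whisker_exchange _ _).symm

theorem dotDownUp_comm : dotDownUp k κ ≫ dualDotDownUp k κ = dualDotDownUp k κ ≫ dotDownUp k κ :=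
  whisker_exchange _ _

/-- Dots on the two legs commute, so they can be carried over the cap one at a time. -/
theorem dualDot_pow_comp_d (n : ℕ) :
    (dualDotUpDown k κ ^ n : End (upObj k κ ⊗ downObj k κ)) ≫ d k κ =
      (dotUpDown k κ ^ n : End (upObj k κ ⊗ downObj k κ)) ≫ d k κ := by
  induction n with
  | zero => rfl
  | succ n ih =>
    have hc : Commute (dotUpDown k κ) (dualDotUpDown k κ) := (dotUpDown_comm k κ).symm
    rw [pow_succ', End.mul_def, Category.assoc, dualDot_comp_d, ← Category.assoc, ← End.mul_def,
      (hc.pow_right n).eq, End.mul_def, Category.assoc, ih, pow_succ, End.mul_def, Category.assoc]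

theorem c_comp_dualDot_pow (n : ℕ) :
    c k κ ≫ (dualDotDownUp k κ ^ n : End (downObj k κ ⊗ upObj k κ)) =
      c k κ ≫ (dotDownUp k κ ^ n : End (downObj k κ ⊗ upObj k κ)) := by
  induction n with
  | zero => rfl
  | succ n ih =>
    have hc : Commute (dotDownUp k κ) (dualDotDownUp k κ) := (dotDownUp_comm k κ).symm
    rw [pow_succ, End.mul_def, ← Category.assoc, c_comp_dualDot, Category.assoc, ← End.mul_def,
      (hc.pow_right n).symm.eq, End.mul_def, ← Category.assoc, ih, pow_succ', End.mul_def,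
      Category.assoc]

theorem ccwNat_eq (n : ℕ) : ccwNat k κ n =
    c k κ ≫ (dotDownUp k κ ^ n : End (downObj k κ ⊗ upObj k κ)) ≫ d' k κ := by
  rw [dotDownUp_pow, ccwNat]

theorem cwNat_eq (n : ℕ) : cwNat k κ n =
    c' k κ ≫ (dotUpDown k κ ^ n : End (upObj k κ ⊗ downObj k κ)) ≫ d k κ := by
  rw [dotUpDown_pow, cwNat]

theorem t_comp_t'_add : t k κ ≫ t' k κ + ∑ r : Fin κ.toNat,
    ((dotUpDown k κ ^ (r : ℕ) : End (upObj k κ ⊗ downObj k κ)) ≫ d k κ) ≫ decCup k κ r =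
      𝟙 (upObj k κ ⊗ downObj k κ) := by
  refine Eq.trans ?_ (Quot.sound (Rel.of (R := Relation k κ) Relation.inv_up_down))
  have h := ofTerm_sum (R := Relation k κ)
    fun r : Fin κ.toNat => (dotCapT k κ r).comp (decCupT k κ r)
  simp only [← ofTerm_dotCapT, ← ofTerm_tT]
  exact congrArg (fun m => ofTerm (Relation k κ) (tT k κ) ≫ t' k κ + m) h.symm

theorem t'_comp_t_add : t' k κ ≫ t k κ + ∑ r : Fin (-κ).toNat,
    decCap k κ r ≫ c k κ ≫ (dotDownUp k κ ^ (r : ℕ) : End (downObj k κ ⊗ upObj k κ)) =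
      𝟙 (downObj k κ ⊗ upObj k κ) := by
  refine Eq.trans ?_ (Quot.sound (Rel.of (R := Relation k κ) Relation.inv_down_up))
  have h := ofTerm_sum (R := Relation k κ)
    fun r : Fin (-κ).toNat => (decCapT k κ r).comp (dotCupT k κ r)
  simp only [← ofTerm_dotCupT, ← ofTerm_tT]
  exact congrArg (fun m => t' k κ ≫ ofTerm (Relation k κ) (tT k κ) + m) h.symm

theorem decCup_comp_t (r : Fin κ.toNat) : decCup k κ r ≫ t k κ = 0 := by
  rw [← ofTerm_tT]
  exact Quot.sound (Rel.of (Relation.decCup_t r))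

theorem t'_comp_dotCap (r : Fin κ.toNat) :
    t' k κ ≫ (dotUpDown k κ ^ (r : ℕ) : End (upObj k κ ⊗ downObj k κ)) ≫ d k κ = 0 := by
  rw [← ofTerm_dotCapT]
  exact Quot.sound (Rel.of (Relation.t'_dotCap r))

theorem decCup_comp_dotCap (r s : Fin κ.toNat) :
    decCup k κ r ≫ (dotUpDown k κ ^ (s : ℕ) : End (upObj k κ ⊗ downObj k κ)) ≫ d k κ =
      if r = s then 𝟙 (𝟙_ (Heis k κ)) else 0 := by
  rw [← ofTerm_dotCapT]
  split_ifs with h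
  · subst h
    exact Quot.sound (Rel.of (Relation.decCup_dotCap_self r))
  · exact Quot.sound (Rel.of (Relation.decCup_dotCap_ne r s h))

theorem dotCup_comp_t' (r : Fin (-κ).toNat) :
    c k κ ≫ (dotDownUp k κ ^ (r : ℕ) : End (downObj k κ ⊗ upObj k κ)) ≫ t' k κ = 0 := by
  rw [← Category.assoc, ← ofTerm_dotCupT]
  exact Quot.sound (Rel.of (Relation.dotCup_t' r))

theorem t_comp_decCap (r : Fin (-κ).toNat) : t k κ ≫ decCap k κ r = 0 := by
  rw [← ofTerm_tT]
  exact Quot.sound (Rel.of (Relation.t_decCap r))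

theorem dotCup_comp_decCap (r s : Fin (-κ).toNat) :
    c k κ ≫ (dotDownUp k κ ^ (r : ℕ) : End (downObj k κ ⊗ upObj k κ)) ≫ decCap k κ s =
      if r = s then 𝟙 (𝟙_ (Heis k κ)) else 0 := by
  rw [← Category.assoc, ← ofTerm_dotCupT]
  split_ifs with h
  · subst h
    exact Quot.sound (Rel.of (Relation.dotCup_decCap_self r))
  · exact Quot.sound (Rel.of (Relation.dotCup_decCap_ne r s h))

/-- For nonnegative central charge, the inversion relation inverts a column. -/
theorem columnInversion (N : ℕ) (hκ : κ = N) :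
    ColumnInversion N (t k κ) (t' k κ) (dotUpDown k κ) (dotDownUp k κ) (c k κ) (d k κ)
      (fun r => if h : r < κ.toNat then decCup k κ ⟨r, h⟩ else 0) (c' k κ) (d' k κ) where
  slide := t_comp_dot k κ
  comp_inv := by
    obtain rfl : N = κ.toNat := by omega
    rw [← t_comp_t'_add k κ, Finset.sum_range]
    simp only [Fin.is_lt, ↓reduceDIte, Fin.eta]
  inv_comp := by
    have h := t'_comp_t_add k κ
    -- For `κ ≥ 0` there are no decorated caps, so `t'` is a right inverse to nothing more than `t`:
    -- the sum in the relation is empty.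
    have : IsEmpty (Fin (-κ).toNat) := by
      rw [show (-κ).toNat = 0 by omega]
      infer_instance
    rwa [Finset.univ_eq_empty, Finset.sum_empty, add_zero] at h
  cup_comp r hr := by
    rw [dif_pos (by omega), decCup_comp_t]
  inv_cap r hr := t'_comp_dotCap k κ ⟨r, by omega⟩
  cup_cap r s hr hs := by
    rw [dif_pos (by omega)]
    refine (decCup_comp_dotCap k κ ⟨r, by omega⟩ ⟨s, by omega⟩).trans ?_
    simp
  cup_zero h := by
    rw [c', dif_neg (by omega), show (-κ).toNat = 0 by omega, pow_zero, End.one_def,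
      whiskerLeft_id, Category.id_comp]
  cup_succ M h := by
    rw [c', dif_pos (by omega), dif_pos (by omega)]
    congr 3
    omega
  cap_eq := by
    rw [d', dif_neg (by omega), dotUpDown_pow, show κ.toNat = N by omega]

/-- For negative central charge, the inversion relation inverts a row. -/
theorem rowInversion (M : ℕ) (hκ : κ = -(M + 1)) :
    RowInversion M (t k κ) (t' k κ) (dotUpDown k κ) (dotDownUp k κ) (c k κ) (d k κ)
      (fun r => if h : r < (-κ).toNat then decCap k κ ⟨r, h⟩ else 0) (c' k κ) (d' k κ) where
  slide := t_comp_dot k κ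
  comp_inv := by
    have h := t_comp_t'_add k κ
    have : IsEmpty (Fin κ.toNat) := by
      rw [show κ.toNat = 0 by omega]
      infer_instance
    rwa [Finset.univ_eq_empty, Finset.sum_empty, add_zero] at h
  inv_comp := by
    rw [← t'_comp_t_add k κ, show M + 1 = (-κ).toNat by omega, Finset.sum_range]
    simp only [Fin.is_lt, ↓reduceDIte, Fin.eta]
  comp_cap r hr := by
    rw [dif_pos (by omega), t_comp_decCap]
  cup_inv r hr := dotCup_comp_t' k κ ⟨r, by omega⟩
  cup_cap r s hr hs := by
    rw [dif_pos (by omega)]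
    refine (dotCup_comp_decCap k κ ⟨r, by omega⟩ ⟨s, by omega⟩).trans ?_
    simp
  cap_eq := by
    rw [d', dif_pos (by omega), dif_pos (by omega)]
    congr 2
    omega
  cup_eq := by
    rw [c', dif_neg (by omega), dotDownUp_pow, show (-κ).toNat = M + 1 by omega]

end Heisenberg

/-! ### The infinite Grassmannian relation and the curl relations. -/

namespace Finset.Nat

open Finset.HasAntidiagonal (antidiagonal)

theorem sum_antidiagonal_add_of_eq_zero {M : Type*} [AddCommMonoid M] (f : ℕ → ℕ → M) (m n : ℕ)
    (h : ∀ a b, b < n → f a b = 0) :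
    ∑ p ∈ antidiagonal (m + n), f p.1 p.2 = ∑ p ∈ antidiagonal m, f p.1 (p.2 + n) := by
  rcases n with _ | n
  · rfl
  · rw [← add_assoc, add_comm m n, sum_antidiagonal_add_add_one,
      Finset.sum_eq_zero (s := antidiagonal n),
      add_zero]
    · rfl
    · intro p hp
      rw [Finset.HasAntidiagonal.mem_antidiagonal] at hp
      exact h _ _ (by omega)

end Finset.Nat

namespace Heisenberg

open StrictPresentation Strand
open Finset.HasAntidiagonal (antidiagonal mem_antidiagonal)

variable (k : Type u) [CommRing k] (κ : ℤ)

/-- The generating function of the counterclockwise bubbles. -/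
noncomputable def ccwSeries : PowerSeries (End (𝟙_ (Heis k κ))) :=
  PowerSeries.mk fun r => ccw k κ ((r : ℤ) - κ - 1)

/-- The generating function of the negatives of the clockwise bubbles. -/
noncomputable def cwSeries : PowerSeries (End (𝟙_ (Heis k κ))) :=
  PowerSeries.mk fun r => -cw k κ ((r : ℤ) + κ - 1)

theorem ccw_of_nonneg (n : ℕ) (m : ℤ) (h : m = n) : ccw k κ m = ccwNat k κ n := by
  subst h
  rw [ccw, if_pos (by omega), Int.toNat_natCast]

theorem cw_of_nonneg (n : ℕ) (m : ℤ) (h : m = n) : cw k κ m = cwNat k κ n := by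
  subst h
  rw [cw, if_pos (by omega), Int.toNat_natCast]

theorem ccw_of_neg (r : ℕ) (h : (r : ℤ) - κ - 1 < 0) : ccw k κ ((r : ℤ) - κ - 1) =
    (Matrix.of fun i j : Fin r => cwNat k κ ((i : ℤ) - (j : ℤ) + κ).toNat).det := by
  rw [ccw, if_neg (by omega), if_neg (by omega)]
  rw [show ((r : ℤ) - κ - 1 + κ + 1).toNat = r by omega]

theorem cw_of_neg (r : ℕ) (h : (r : ℤ) + κ - 1 < 0) : cw k κ ((r : ℤ) + κ - 1) =
    -(Matrix.of fun i j : Fin r => -ccwNat k κ ((i : ℤ) - (j : ℤ) - κ).toNat).det := by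
  rw [cw, if_neg (by omega), if_neg (by omega)]
  rw [show ((r : ℤ) + κ - 1 - κ + 1).toNat = r by omega]

theorem coeffHom_ccwSeries (i n : ℕ) (h : (i : ℤ) = n + κ + 1) :
    coeffHom i (ccwSeries k κ) = ccwNat k κ n := by
  rw [coeffHom, ccwSeries, PowerSeries.coeff_mk, ccw_of_nonneg k κ n _ (by omega)]

theorem coeffHom_cwSeries (i n : ℕ) (h : (i : ℤ) + κ = n + 1) :
    coeffHom i (cwSeries k κ) = -cwNat k κ n := by
  rw [coeffHom, cwSeries, PowerSeries.coeff_mk, cw_of_nonneg k κ n _ (by omega)]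

theorem ccwNat_eq_ite (M n : ℕ) (hκ : κ = -(M + 1)) (h : n ≤ M) :
    ccwNat k κ n = if n = M then 1 else 0 := by
  rw [ccwNat_eq]
  exact (rowInversion k κ M hκ).cup_dot_cap n h

/-- The inversion relation pairs the decorated cups with the dotted caps as dual bases. The sign of
`c'` gives the value -1, so the series of negated clockwise bubbles starts with 1. -/
theorem cwNat_eq_ite (M n : ℕ) (hκ : κ = M + 1) (h : n ≤ M) :
    cwNat k κ n = if n = M then -1 else 0 := by
  rw [cwNat_eq]
  refine ((columnInversion k κ (M + 1) (by omega)).cup_dot_cap n (by omega)).trans ?_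
  simp only [add_left_inj]
  rfl

theorem ccwNat_eq_zero (n : ℕ) (h : n + κ + 1 < 0) : ccwNat k κ n = 0 := by
  rw [ccwNat_eq_ite k κ (-κ - 1).toNat n (by omega) (by omega), if_neg (by omega)]

theorem cwNat_eq_zero (n : ℕ) (h : n + 1 < κ) : cwNat k κ n = 0 := by
  rw [cwNat_eq_ite k κ (κ - 1).toNat n (by omega) (by omega), if_neg (by omega)]

theorem coeff_zero_ccwSeries : PowerSeries.coeff 0 (ccwSeries k κ) = 1 := by
  rw [ccwSeries, PowerSeries.coeff_mk]
  rcases lt_or_ge κ 0 with h | h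
  · rw [ccw_of_nonneg k κ (-κ - 1).toNat _ (by omega),
      ccwNat_eq_ite k κ (-κ - 1).toNat _ (by omega) le_rfl, if_pos rfl]
  · rw [ccw_of_neg k κ 0 (by omega), Matrix.det_fin_zero]

theorem coeff_zero_cwSeries : PowerSeries.coeff 0 (cwSeries k κ) = 1 := by
  rw [cwSeries, PowerSeries.coeff_mk]
  rcases lt_or_ge 0 κ with h | h
  · rw [cw_of_nonneg k κ (κ - 1).toNat _ (by omega),
      cwNat_eq_ite k κ (κ - 1).toNat _ (by omega) le_rfl, if_pos rfl, neg_neg]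
  · rw [cw_of_neg k κ 0 (by omega), Matrix.det_fin_zero, neg_neg]

theorem exists_mul_eq_one {R : Type*} [CommRing R] {B : PowerSeries R}
    (h : PowerSeries.coeff 0 B = 1) : ∃ A : PowerSeries R, A * B = 1 :=
  ⟨B.invOfUnit 1, by
    rw [mul_comm]
    exact PowerSeries.mul_invOfUnit B 1 (by simpa using h)⟩

theorem ccwSeries_mul_cwSeries_of_nonneg (N : ℕ) (hκ : κ = N) :
    ccwSeries k κ * cwSeries k κ = 1 := by
  -- Take the formal inverse and identify its coefficients: dotted bubbles above degree `N`, and the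
  -- defining determinants in degrees up to `N`.
  obtain ⟨A, hA⟩ := exists_mul_eq_one (coeff_zero_cwSeries k κ)
  have H := columnInversion k κ N hκ
  suffices h : ccwSeries k κ = A by rw [h, hA]
  ext r
  rcases Nat.lt_or_ge N r with hr | hr
  · obtain ⟨m, rfl⟩ : ∃ m, r = m + N + 1 := ⟨r - N - 1, by omega⟩
    refine (coeffHom_ccwSeries k κ _ m (by omega)).trans ?_
    rw [ccwNat_eq]
    refine H.ccwBubble_eq hA (coeff_zero_cwSeries k κ) (fun i m h => ?_) m
    rw [coeffHom_cwSeries k κ i m (by omega), cwNat_eq]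
  · rw [PowerSeries.coeff_eq_det_of_mul_eq_one hA (coeff_zero_cwSeries k κ), ccwSeries,
      PowerSeries.coeff_mk, ccw_of_neg k κ r (by omega)]
    congr 2
    funext i j
    have hi := i.2
    have hj := j.2
    split_ifs with h
    · refine Eq.trans ?_ (congrArg Neg.neg
        (coeffHom_cwSeries k κ (i + 1 - j) ((i : ℤ) - j + κ).toNat (by omega)).symm)
      exact (neg_neg _).symm
    -- Above the superdiagonal the number of dots i - j + κ is positive but less than κ - 1, where
    -- clockwise bubbles vanish; this gives the Hessenberg shape of the determinant.
    · exact cwNat_eq_zero k κ _ (by omega)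

theorem cwSeries_mul_ccwSeries_of_neg (M : ℕ) (hκ : κ = -(M + 1)) :
    cwSeries k κ * ccwSeries k κ = 1 := by
  obtain ⟨B, hB⟩ := exists_mul_eq_one (coeff_zero_ccwSeries k κ)
  have H := rowInversion k κ M hκ
  suffices h : cwSeries k κ = B by rw [h, hB]
  ext r
  rcases Nat.lt_or_ge (M + 1) r with hr | hr
  · obtain ⟨m, rfl⟩ : ∃ m, r = m + (M + 1) + 1 := ⟨r - (M + 1) - 1, by omega⟩
    refine (coeffHom_cwSeries k κ _ m (by omega)).trans ?_
    rw [cwNat_eq]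
    refine H.neg_cwBubble_eq hB (coeff_zero_ccwSeries k κ) (fun i m h => ?_) m
    rw [coeffHom_ccwSeries k κ i m (by omega), ccwNat_eq]
  · rw [PowerSeries.coeff_eq_det_of_mul_eq_one hB (coeff_zero_ccwSeries k κ), cwSeries,
      PowerSeries.coeff_mk, cw_of_neg k κ r (by omega), neg_neg]
    congr 2
    funext i j
    have hi := i.2
    have hj := j.2
    split_ifs with h
    · exact congrArg Neg.neg
        (coeffHom_ccwSeries k κ (i + 1 - j) ((i : ℤ) - j - κ).toNat (by omega)).symm
    · rw [ccwNat_eq_zero k κ _ (by omega), neg_zero]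

/-- The infinite Grassmannian relation. -/
theorem ccwSeries_mul_cwSeries : ccwSeries k κ * cwSeries k κ = 1 := by
  rcases lt_or_ge κ 0 with h | h
  · rw [mul_comm]
    exact cwSeries_mul_ccwSeries_of_neg k κ (-κ - 1).toNat (by omega)
  · exact ccwSeries_mul_cwSeries_of_nonneg k κ κ.toNat (by omega)

theorem t_comp_leftCap (N : ℕ) (hκ : κ = N) : t k κ ≫ d' k κ = ∑ p ∈ antidiagonal N,
    ((dotUpDown k κ ^ p.1 : End (upObj k κ ⊗ downObj k κ)) ≫ d k κ) ≫
      coeffHom p.2 (ccwSeries k κ) := by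
  refine (columnInversion k κ N hκ).comp_leftCap (ccwSeries_mul_cwSeries k κ)
    (coeff_zero_cwSeries k κ) fun i m h => ?_
  rw [coeffHom_cwSeries k κ i m (by omega), cwNat_eq]

theorem t_comp_leftCap_of_neg (h : κ < 0) : t k κ ≫ d' k κ = 0 :=
  (rowInversion k κ (-κ - 1).toNat (by omega)).comp_leftCap

theorem leftCup_comp_t (N : ℕ) (hκ : κ = -N) : c' k κ ≫ t k κ = ∑ p ∈ antidiagonal N,
    coeffHom p.2 (cwSeries k κ) ≫ c k κ ≫
      (dotDownUp k κ ^ p.1 : End (downObj k κ ⊗ upObj k κ)) := by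
  rcases N with _ | M
  -- Central charge zero belongs to the column case.
  · have h := (columnInversion k κ 0 (by omega)).leftCup_comp
    have h0 : coeffHom 0 (cwSeries k κ) = 𝟙 _ := coeff_zero_cwSeries k κ
    rw [h, if_pos rfl, Finset.Nat.antidiagonal_zero, Finset.sum_singleton, h0, pow_zero,
      End.one_def, Category.comp_id, Category.id_comp]
  · refine (rowInversion k κ M (by omega)).leftCup_comp
      (cwSeries_mul_ccwSeries_of_neg k κ M (by omega)) (coeff_zero_ccwSeries k κ) fun i m h => ?_
    rw [coeffHom_ccwSeries k κ i m (by omega), ccwNat_eq]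

theorem leftCup_comp_t_of_pos (h : 0 < κ) : c' k κ ≫ t k κ = 0 := by
  rw [(columnInversion k κ κ.toNat (by omega)).leftCup_comp, if_neg (by omega)]

theorem t_comp_dot_pow_leftCap (n : ℕ) :
    t k κ ≫ (dotDownUp k κ ^ (n + 1) : End (downObj k κ ⊗ upObj k κ)) ≫ d' k κ =
      (dotUpDown k κ ^ (n + 1) : End (upObj k κ ⊗ downObj k κ)) ≫ t k κ ≫ d' k κ +
        ∑ p ∈ antidiagonal n,
          ((dotUpDown k κ ^ p.1 : End (upObj k κ ⊗ downObj k κ)) ≫ d k κ) ≫ ccwNat k κ p.2 := by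
  rw [← Category.assoc, comp_pow_of_comp_eq (t_comp_dot k κ), Preadditive.add_comp,
    Preadditive.sum_comp]
  simp only [Category.assoc, ccwNat_eq]

theorem leftCup_dualDot_pow_comp_t (n : ℕ) :
    c' k κ ≫ (dualDotUpDown k κ ^ (n + 1) : End (upObj k κ ⊗ downObj k κ)) ≫ t k κ =
      (c' k κ ≫ t k κ) ≫ (dualDotDownUp k κ ^ (n + 1) : End (downObj k κ ⊗ upObj k κ)) -
        ∑ p ∈ antidiagonal n, cwNat k κ p.1 ≫ c k κ ≫
          (dotDownUp k κ ^ p.2 : End (downObj k κ ⊗ upObj k κ)) := by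
  rw [Category.assoc, comp_pow_of_comp_eq (t_comp_dualDot k κ), Preadditive.comp_add,
    Preadditive.comp_sum, eq_sub_iff_add_eq, add_right_inj]
  refine Finset.sum_congr rfl fun p _ => ?_
  rw [cwNat_eq, ← dualDot_pow_comp_d, ← c_comp_dualDot_pow]
  simp only [Category.assoc]

/-- The curl relation for a downward strand. -/
theorem downCurl (n m : ℕ) (h : (m : ℤ) = n + κ) :
    t k κ ≫ (dotDownUp k κ ^ n : End (downObj k κ ⊗ upObj k κ)) ≫ d' k κ =
      ∑ p ∈ antidiagonal m,
        ((dotUpDown k κ ^ p.1 : End (upObj k κ ⊗ downObj k κ)) ≫ d k κ) ≫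
          coeffHom p.2 (ccwSeries k κ) := by
  rcases n with _ | n
  · rw [pow_zero, End.one_def, Category.id_comp, t_comp_leftCap k κ m (by omega)]
  rw [t_comp_dot_pow_leftCap]
  rcases lt_or_ge κ 0 with hκ | hκ
  · obtain ⟨M, rfl⟩ : ∃ M : ℕ, κ = -(M + 1) := ⟨(-κ - 1).toNat, by omega⟩
    obtain rfl : n = m + M := by omega
    rw [t_comp_leftCap_of_neg k _ hκ, Limits.comp_zero, zero_add,
      -- For negative charge, bubbles with fewer than `M` dots vanish; dropping them shifts the
      -- degree to the index of the series.
      Finset.Nat.sum_antidiagonal_add_of_eq_zero (fun a b =>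
        ((dotUpDown k _ ^ a : End (upObj k _ ⊗ downObj k _)) ≫ d k _) ≫ ccwNat k _ b) m M]
    · refine Finset.sum_congr rfl fun p _ => ?_
      rw [coeffHom_ccwSeries k _ p.2 (p.2 + M) (by omega)]
    · intro a b hb
      rw [ccwNat_eq_zero k _ b (by omega)]
      exact Limits.comp_zero
  · obtain ⟨N, rfl⟩ : ∃ N : ℕ, κ = N := ⟨κ.toNat, by omega⟩
    obtain rfl : m = N + n + 1 := by omega
    rw [Finset.Nat.sum_antidiagonal_add_add_one (fun a b =>
        ((dotUpDown k _ ^ a : End (upObj k _ ⊗ downObj k _)) ≫ d k _) ≫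
          coeffHom b (ccwSeries k _)), add_comm, t_comp_leftCap k _ N rfl, Preadditive.comp_sum]
    congr 1
    · refine Finset.sum_congr rfl fun p _ => ?_
      rw [coeffHom_ccwSeries k _ (p.2 + N + 1) p.2 (by omega)]
    · refine Finset.sum_congr rfl fun p _ => ?_
      have hX : (dotUpDown k (N : ℤ) ^ (p.1 + (n + 1)) : End (upObj k _ ⊗ downObj k _)) =
          (dotUpDown k (N : ℤ) ^ (n + 1) : End (upObj k _ ⊗ downObj k _)) ≫
            (dotUpDown k (N : ℤ) ^ p.1 : End (upObj k _ ⊗ downObj k _)) := by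
        rw [pow_add _ p.1, End.mul_def]
      rw [add_assoc p.1, hX]
      simp only [Category.assoc]

theorem downCurl_of_neg (n : ℕ) (h : n + κ < 0) :
    t k κ ≫ (dotDownUp k κ ^ n : End (downObj k κ ⊗ upObj k κ)) ≫ d' k κ = 0 := by
  rcases n with _ | n
  · rw [pow_zero, End.one_def, Category.id_comp, t_comp_leftCap_of_neg k κ (by omega)]
  rw [t_comp_dot_pow_leftCap, t_comp_leftCap_of_neg k κ (by omega), Limits.comp_zero, zero_add]
  refine Finset.sum_eq_zero fun p hp => ?_
  rw [mem_antidiagonal] at hp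
  rw [ccwNat_eq_zero k κ p.2 (by omega)]
  exact Limits.comp_zero

/-- The curl relation for an upward strand. -/
theorem upCurl (n m : ℕ) (h : (m : ℤ) = n - κ) :
    c' k κ ≫ (dualDotUpDown k κ ^ n : End (upObj k κ ⊗ downObj k κ)) ≫ t k κ =
      ∑ p ∈ antidiagonal m, coeffHom p.2 (cwSeries k κ) ≫ c k κ ≫
        (dotDownUp k κ ^ p.1 : End (downObj k κ ⊗ upObj k κ)) := by
  rcases n with _ | n
  · rw [pow_zero, End.one_def, Category.id_comp, leftCup_comp_t k κ m (by omega)]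
  rw [leftCup_dualDot_pow_comp_t, ← Finset.Nat.sum_antidiagonal_swap]
  simp only [Prod.fst_swap, Prod.snd_swap]
  rcases lt_or_ge 0 κ with hκ | hκ
  · obtain ⟨M, rfl⟩ : ∃ M : ℕ, κ = M + 1 := ⟨(κ - 1).toNat, by omega⟩
    obtain rfl : n = m + M := by omega
    rw [leftCup_comp_t_of_pos k _ hκ, Limits.zero_comp, zero_sub,
      Finset.Nat.sum_antidiagonal_add_of_eq_zero (fun a b => cwNat k _ b ≫ c k _ ≫
          (dotDownUp k _ ^ a : End (downObj k _ ⊗ upObj k _))) m M, ← Finset.sum_neg_distrib]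
    · refine Finset.sum_congr rfl fun p _ => ?_
      rw [coeffHom_cwSeries k _ p.2 (p.2 + M) (by omega)]
      exact (Preadditive.neg_comp _ _).symm
    · intro a b hb
      rw [cwNat_eq_zero k _ b (by omega)]
      exact Limits.zero_comp
  · obtain ⟨N, rfl⟩ : ∃ N : ℕ, κ = -N := ⟨(-κ).toNat, by omega⟩
    obtain rfl : m = N + n + 1 := by omega
    rw [Finset.Nat.sum_antidiagonal_add_add_one (fun a b => coeffHom b (cwSeries k _) ≫ c k _ ≫
        (dotDownUp k _ ^ a : End (downObj k _ ⊗ upObj k _))), add_comm (Finset.sum _ _),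
            leftCup_comp_t k _ N rfl,
      Preadditive.sum_comp, sub_eq_add_neg, ← Finset.sum_neg_distrib]
    congr 1
    -- The dual dots are commuted past the ordinary ones to reach the cup, where both kinds agree.
    · refine Finset.sum_congr rfl fun p _ => ?_
      have hc : Commute (dotDownUp k (-N)) (dualDotDownUp k (-N)) := (dotDownUp_comm k _).symm
      rw [add_assoc p.1, Category.assoc, Category.assoc, ← End.mul_def,
        ← (hc.pow_pow p.1 (n + 1)).eq, End.mul_def, ← Category.assoc (c k _),
        c_comp_dualDot_pow, Category.assoc, ← End.mul_def, ← pow_add]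
    · refine Finset.sum_congr rfl fun p _ => ?_
      rw [coeffHom_cwSeries k _ (p.2 + N + 1) p.2 (by omega)]
      exact (Preadditive.neg_comp _ _).symm

theorem upCurl_of_neg (n : ℕ) (h : n - κ < 0) :
    c' k κ ≫ (dualDotUpDown k κ ^ n : End (upObj k κ ⊗ downObj k κ)) ≫ t k κ = 0 := by
  rcases n with _ | n
  · rw [pow_zero, End.one_def, Category.id_comp, leftCup_comp_t_of_pos k κ (by omega)]
  rw [leftCup_dualDot_pow_comp_t, leftCup_comp_t_of_pos k κ (by omega), Limits.zero_comp, zero_sub,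
    neg_eq_zero]
  refine Finset.sum_eq_zero fun p hp => ?_
  rw [mem_antidiagonal] at hp
  rw [cwNat_eq_zero k κ p.1 (by omega)]
  exact Limits.zero_comp

end Heisenberg

/-! ### Power series modulo an ideal -/

namespace PowerSeries

open Finset.HasAntidiagonal (antidiagonal mem_antidiagonal)

variable {R : Type*} [CommRing R] {J : Ideal R}

theorem coeff_mul_mem {E : PowerSeries R} (hE : ∀ i, coeff i E ∈ J) (G : PowerSeries R) (i : ℕ) :
    coeff i (G * E) ∈ J := by
  rw [coeff_mul]
  exact Ideal.sum_mem _ fun p _ => J.mul_mem_left _ (hE p.2)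

/-- Strong induction: a coefficient of `E * F` is the same coefficient of `E` plus multiples of its
lower coefficients. -/
theorem coeff_mem_of_coeff_mul_mem {E F : PowerSeries R} (hF : coeff 0 F = 1) (n : ℕ)
    (h₁ : ∀ i ≤ n, coeff i E ∈ J) (h₂ : ∀ i, n < i → coeff i (E * F) ∈ J) (i : ℕ) :
    coeff i E ∈ J := by
  induction i using Nat.strong_induction_on with
  | _ i ih =>
  rcases Nat.lt_or_ge n i with hi | hi
  · obtain ⟨j, rfl⟩ : ∃ j, i = j + 1 := ⟨i - 1, by omega⟩
    have h := h₂ _ hi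
    rw [coeff_mul, Finset.Nat.sum_antidiagonal_succ', hF, mul_one] at h
    refine (Ideal.add_mem_iff_left _ (Ideal.sum_mem _ fun p hp => ?_)).mp h
    rw [mem_antidiagonal] at hp
    exact J.mul_mem_right _ (ih p.1 (by omega))
  · exact h₁ i hi

/-- The difference of the inverses is a multiple of the difference: B - D' = -BD'(A - D). -/
theorem coeff_sub_mem_of_mul_eq_one {A B D D' : PowerSeries R} (hAB : A * B = 1)
    (hD : D * D' = 1) (h : ∀ i, coeff i (A - D) ∈ J) (i : ℕ) : coeff i (B - D') ∈ J := by
  have e : B - D' = -(B * D') * (A - D) := by linear_combination D' * hAB - B * hD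
  rw [e]
  exact coeff_mul_mem h _ i

end PowerSeries

/-! ### Sums against the coefficients of a polynomial, rewritten with its reversal. -/

namespace Polynomial

open Finset (range)
open Finset.HasAntidiagonal (antidiagonal mem_antidiagonal)

/-- Substitute i = deg f - p: then i + κ + e = n + e - p, so the sum becomes a convolution of total
degree `n + e`. The shift `e` allows for additional dots, and `h0` covers the indices that would be
negative. -/
theorem sum_coeff_smul_eq_sum_coeff_reverse_smul {k M : Type*} [CommRing k] [AddCommGroup M]
    [Module k M] (f : k[X]) (n e : ℕ) {g T : ℕ → M} {κ : ℤ} (hκ : κ = (n : ℤ) - f.natDegree)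
    (h : ∀ i m : ℕ, (m : ℤ) = i + κ + e → g i = T m) (h0 : ∀ i : ℕ, i + κ + e < 0 → g i = 0) :
    ∑ i ∈ range (f.natDegree + 1), f.coeff i • g i =
      ∑ p ∈ antidiagonal (n + e), f.reverse.coeff p.1 • T p.2 := by
  set S : ℕ → M := fun p => if p ≤ n + e then f.reverse.coeff p • T (n + e - p) else 0
  have h1 : ∑ i ∈ range (f.natDegree + 1), f.coeff i • g i =
      ∑ p ∈ range (f.natDegree + (n + e) + 1), S p := by
    rw [← Finset.sum_range_reflect]
    refine Eq.trans ?_ (Finset.sum_subset (s₁ := range (f.natDegree + 1)) ?_ ?_)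
    · refine Finset.sum_congr rfl fun p hp => ?_
      rw [Finset.mem_range] at hp
      simp only [S]
      rw [coeff_reverse, revAt_le (by omega),
          show f.natDegree + 1 - 1 - p = f.natDegree - p by omega]
      split_ifs with hpn
      · rw [h (f.natDegree - p) (n + e - p) (by omega)]
      · rw [h0 _ (by omega), smul_zero]
    · intro p
      simp only [Finset.mem_range]
      omega
    · intro p _ hp
      rw [Finset.mem_range, not_lt] at hp
      simp only [S]
      rw [coeff_eq_zero_of_natDegree_lt
        (lt_of_le_of_lt (reverse_natDegree_le f) (by omega)), zero_smul, ite_self]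
  rw [h1, Finset.Nat.sum_antidiagonal_eq_sum_range_succ
    (fun a b => f.reverse.coeff a • T b)]
  refine (Finset.sum_subset (s₁ := range (n + e).succ) ?_ ?_).symm.trans ?_
  · intro p
    simp only [Finset.mem_range]
    omega
  · intro p _ hp
    rw [Finset.mem_range, not_lt] at hp
    exact if_neg (by omega)
  · refine Finset.sum_congr rfl fun p hp => ?_
    rw [Finset.mem_range] at hp
    exact if_pos (by omega)

end Polynomial

/-! ### Left tensor ideals -/

namespace LeftTensorIdeal

variable {k : Type*} [CommRing k] {C : Type*} [Category C] [Preadditive C] [Linear k C]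
  [MonoidalCategory C]

theorem whiskerLeft_mem (I : LeftTensorIdeal k C) (X : C) {Y Z : C} {f : Y ⟶ Z}
    (hf : f ∈ I.hom Y Z) : X ◁ f ∈ I.hom (X ⊗ Y) (X ⊗ Z) := by
  rw [← id_tensorHom]
  exact I.tensor_mem _ hf

/-- The endomorphisms of the unit object in a left tensor ideal. -/
def unitIdeal (I : LeftTensorIdeal k C) : Ideal (End (𝟙_ C)) where
  carrier := {a : End (𝟙_ C) | a ∈ I.hom (𝟙_ C) (𝟙_ C)}
  add_mem' := (I.hom (𝟙_ C) (𝟙_ C)).add_mem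
  zero_mem' := (I.hom (𝟙_ C) (𝟙_ C)).zero_mem
  smul_mem' a _ hf := I.postcomp_mem a hf

theorem mem_unitIdeal {I : LeftTensorIdeal k C} {a : End (𝟙_ C)} :
    a ∈ I.unitIdeal ↔ a ∈ I.hom (𝟙_ C) (𝟙_ C) := Iff.rfl

theorem subset_span (S : ∀ ⦃X Y : C⦄, (X ⟶ Y) → Prop) {X Y : C} {f : X ⟶ Y} (hf : S f) :
    f ∈ (span k S).hom X Y := by
  refine (Submodule.mem_iInf _).mpr fun I => I.2 f hf

theorem span_le {S : ∀ ⦃X Y : C⦄, (X ⟶ Y) → Prop} {I : LeftTensorIdeal k C}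
    (h : ∀ ⦃X Y : C⦄ (f : X ⟶ Y), S f → f ∈ I.hom X Y) (X Y : C) :
    (span k S).hom X Y ≤ I.hom X Y :=
  fun _ hf => (Submodule.mem_iInf _).mp hf ⟨I, h⟩

end LeftTensorIdeal

namespace CategoryTheory

/-- The scalar multiples of the identity of the unit object. -/
def unitScalar (k C : Type*) [CommRing k] [Category C] [Preadditive C] [Linear k C]
    [MonoidalCategory C] : k →+* End (𝟙_ C) where
  toFun r := r • 𝟙 (𝟙_ C)
  map_one' := one_smul _ _
  map_mul' r s := by
    rw [End.mul_def, Linear.comp_smul, Category.comp_id, mul_smul]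
  map_zero' := zero_smul _ _
  map_add' r s := add_smul _ _ _

end CategoryTheory

/-! ### Bubbles modulo a left tensor ideal. -/

namespace Heisenberg

open StrictPresentation Strand
open Finset (range)
open Finset.HasAntidiagonal (antidiagonal mem_antidiagonal)

variable {k : Type u} [CommRing k] {κ : ℤ} {f f' : k[X]}

theorem reverse_coeff_zero (hf : f.Monic) :
    PowerSeries.coeff 0 (f.reverse : PowerSeries k) = 1 := by
  rw [Polynomial.coeff_coe, coeff_zero_reverse, hf.leadingCoeff]

theorem reverse_mul_invOfUnit (hf : f.Monic) :
    (f.reverse : PowerSeries k) * PowerSeries.invOfUnit (f.reverse : PowerSeries k) 1 = 1 :=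
  PowerSeries.mul_invOfUnit _ 1 (by simpa using hf.leadingCoeff)

theorem deltaSeries_mul (hf : f.Monic) :
    deltaSeries f f' * (f.reverse : PowerSeries k) = (f'.reverse : PowerSeries k) := by
  rw [deltaSeries]
  linear_combination (f'.reverse : PowerSeries k) * reverse_mul_invOfUnit hf

theorem deltaSeries'_mul (hf' : f'.Monic) :
    -deltaSeries' f f' * (f'.reverse : PowerSeries k) = (f.reverse : PowerSeries k) := by
  rw [deltaSeries']
  linear_combination (f.reverse : PowerSeries k) * reverse_mul_invOfUnit hf'

theorem deltaSeries_mul_deltaSeries' (hf : f.Monic) (hf' : f'.Monic) :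
    deltaSeries f f' * -deltaSeries' f f' = 1 := by
  rw [deltaSeries, deltaSeries']
  linear_combination (f'.reverse : PowerSeries k) *
    PowerSeries.invOfUnit (f'.reverse : PowerSeries k) 1 * reverse_mul_invOfUnit hf +
      reverse_mul_invOfUnit hf'

/-- Extension of scalars for power series, from `k` to the endomorphisms of the unit object. -/
noncomputable abbrev extendScalars (κ : ℤ) (D : PowerSeries k) :
    PowerSeries (End (𝟙_ (Heis k κ))) :=
  PowerSeries.map (unitScalar k (Heis k κ)) D

theorem ccwRel_eq (r : ℕ) : ccwRel κ f f' r =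
    coeffHom r (ccwSeries k κ - extendScalars κ (deltaSeries f f')) := by
  rw [coeffHom, map_sub, ccwSeries, PowerSeries.coeff_mk, PowerSeries.coeff_map]
  rfl

theorem neg_cwRel_eq (r : ℕ) : -cwRel κ f f' r =
    coeffHom r (cwSeries k κ - extendScalars κ (-deltaSeries' f f')) := by
  rw [coeffHom, map_sub, cwSeries, PowerSeries.coeff_mk, PowerSeries.coeff_map, map_neg, map_neg,
    sub_neg_eq_add, cwRel, neg_sub, sub_eq_neg_add]
  rfl

theorem ccwRel_mem_iff (I : LeftTensorIdeal k (Heis k κ)) (r : ℕ) :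
    ccwRel κ f f' r ∈ I.hom (𝟙_ _) (𝟙_ _) ↔ PowerSeries.coeff r
      (ccwSeries k κ - extendScalars κ (deltaSeries f f')) ∈ I.unitIdeal := by
  rw [ccwRel_eq]
  rfl

theorem cwRel_mem_iff (I : LeftTensorIdeal k (Heis k κ)) (r : ℕ) :
    cwRel κ f f' r ∈ I.hom (𝟙_ _) (𝟙_ _) ↔ PowerSeries.coeff r
      (cwSeries k κ - extendScalars κ (-deltaSeries' f f')) ∈ I.unitIdeal := by
  rw [← neg_mem_iff, neg_cwRel_eq]
  rfl

theorem extendScalars_mul (hf : f.Monic) (hf' : f'.Monic) :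
    extendScalars κ (deltaSeries f f') * extendScalars κ (-deltaSeries' f f') = 1 := by
  rw [← map_mul, deltaSeries_mul_deltaSeries' hf hf', map_one]

/-- If all counterclockwise bubbles are scalars modulo a left tensor ideal, then so are the
clockwise ones. -/
theorem cwRel_mem_of_ccwRel_mem (hf : f.Monic) (hf' : f'.Monic)
    {I : LeftTensorIdeal k (Heis k κ)} (h : ∀ r, ccwRel κ f f' r ∈ I.hom (𝟙_ _) (𝟙_ _)) (r : ℕ) :
    cwRel κ f f' r ∈ I.hom (𝟙_ _) (𝟙_ _) := by
  rw [cwRel_mem_iff]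
  exact PowerSeries.coeff_sub_mem_of_mul_eq_one (ccwSeries_mul_cwSeries k κ)
    (extendScalars_mul hf hf') (fun i => (ccwRel_mem_iff I i).mp (h i)) r

theorem ccwRel_mem_of_cwRel_mem (hf : f.Monic) (hf' : f'.Monic)
    {I : LeftTensorIdeal k (Heis k κ)} (h : ∀ r, cwRel κ f f' r ∈ I.hom (𝟙_ _) (𝟙_ _)) (r : ℕ) :
    ccwRel κ f f' r ∈ I.hom (𝟙_ _) (𝟙_ _) := by
  rw [ccwRel_mem_iff]
  refine PowerSeries.coeff_sub_mem_of_mul_eq_one ?_ ?_ (fun i => (cwRel_mem_iff I i).mp (h i)) r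
  · rw [mul_comm, ccwSeries_mul_cwSeries]
  · rw [mul_comm, extendScalars_mul hf hf']

end Heisenberg

/-! ### Polynomials in dots inside bubbles and curls, and their consequences for ideals. -/

namespace Finset.Nat

theorem sum_antidiagonal_sum_antidiagonal_comm {M : Type*} [AddCommMonoid M]
    (φ : ℕ → ℕ → ℕ → M) (n : ℕ) :
    ∑ p ∈ HasAntidiagonal.antidiagonal n, ∑ q ∈ HasAntidiagonal.antidiagonal p.2, φ p.1 q.1 q.2 =
      ∑ p ∈ HasAntidiagonal.antidiagonal n, ∑ q ∈ HasAntidiagonal.antidiagonal p.2,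
        φ q.1 p.1 q.2 := by
  rw [Finset.sum_sigma', Finset.sum_sigma']
  refine Finset.sum_nbij' (fun a => ⟨(a.2.1, a.1.1 + a.2.2), (a.1.1, a.2.2)⟩)
    (fun a => ⟨(a.2.1, a.1.1 + a.2.2), (a.1.1, a.2.2)⟩) ?_ ?_ ?_ ?_ ?_ <;>
  · rintro ⟨⟨a, b⟩, c, d⟩
    simp only [mem_sigma, HasAntidiagonal.mem_antidiagonal]
    rintro ⟨h1, h2⟩
    subst h1 h2
    simp [add_left_comm]

end Finset.Nat

namespace Heisenberg

open StrictPresentation Strand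
open Finset (range)
open Finset.HasAntidiagonal (antidiagonal mem_antidiagonal)

variable {k : Type u} [CommRing k] {κ : ℤ} {f f' : k[X]}

theorem coeffHom_extendScalars (D : PowerSeries k) (n : ℕ) :
    coeffHom n (extendScalars κ D) = PowerSeries.coeff n D • 𝟙 (𝟙_ (Heis k κ)) := by
  rw [coeffHom, PowerSeries.coeff_map]
  rfl

theorem coeffHom_mul_extendScalars (A : PowerSeries (End (𝟙_ (Heis k κ)))) (D : PowerSeries k)
    (n : ℕ) : coeffHom n (A * extendScalars κ D) =
      ∑ p ∈ antidiagonal n, PowerSeries.coeff p.1 D • coeffHom p.2 A := by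
  rw [coeffHom, PowerSeries.coeff_mul, ← Finset.Nat.sum_antidiagonal_swap]
  refine Finset.sum_congr rfl fun p _ => ?_
  rw [Prod.fst_swap, Prod.snd_swap, End.mul_def]
  change coeffHom p.1 (extendScalars κ D) ≫ coeffHom p.2 A = _
  rw [coeffHom_extendScalars, Linear.smul_comp, Category.id_comp]

theorem whiskerLeft_polyUp : downObj k κ ◁ polyUp κ f =
    ∑ i ∈ range (f.natDegree + 1),
      f.coeff i • (dotDownUp k κ ^ i : End (downObj k κ ⊗ upObj k κ)) := by
  rw [polyUp, aeval_eq_sum_range, whiskerLeft_sum]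
  refine Finset.sum_congr rfl fun i _ => ?_
  rw [dotDownUp_pow]
  exact MonoidalLinear.whiskerLeft_smul _ _ _

theorem whiskerLeft_polyDown : upObj k κ ◁ polyDown κ f' =
    ∑ i ∈ range (f'.natDegree + 1),
      f'.coeff i • (dualDotUpDown k κ ^ i : End (upObj k κ ⊗ downObj k κ)) := by
  rw [polyDown, aeval_eq_sum_range, whiskerLeft_sum]
  refine Finset.sum_congr rfl fun i _ => ?_
  rw [dualDotUpDown_pow]
  exact MonoidalLinear.whiskerLeft_smul _ _ _

theorem c_comp_polyUp : c k κ ≫ downObj k κ ◁ polyUp κ f =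
    ∑ p ∈ antidiagonal f.natDegree, coeffHom p.2 (extendScalars κ (f.reverse : PowerSeries k)) ≫
      c k κ ≫ (dotDownUp k κ ^ p.1 : End (downObj k κ ⊗ upObj k κ)) := by
  rw [whiskerLeft_polyUp, Preadditive.comp_sum, Finset.Nat.sum_antidiagonal_eq_sum_range_succ_mk]
  refine Finset.sum_congr rfl fun i hi => ?_
  rw [Finset.mem_range] at hi
  rw [coeffHom_extendScalars, Linear.smul_comp, Category.id_comp, Polynomial.coeff_coe,
    coeff_reverse, revAt_le (by omega), show f.natDegree - (f.natDegree - i) = i by omega]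
  exact Linear.comp_smul _ _ _ _ _ _

/-- Written with the reversed polynomial so that it can be compared term by term with the curl
expansion `downCurl_polyUp`. -/
theorem polyDown_comp_d : upObj k κ ◁ polyDown κ f' ≫ d k κ =
    ∑ p ∈ antidiagonal f'.natDegree,
      ((dotUpDown k κ ^ p.1 : End (upObj k κ ⊗ downObj k κ)) ≫ d k κ) ≫
        coeffHom p.2 (extendScalars κ (f'.reverse : PowerSeries k)) := by
  rw [whiskerLeft_polyDown, Preadditive.sum_comp, Finset.Nat.sum_antidiagonal_eq_sum_range_succ_mk]
  refine Finset.sum_congr rfl fun i hi => ?_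
  rw [Finset.mem_range] at hi
  rw [coeffHom_extendScalars, Linear.comp_smul, Category.comp_id, Polynomial.coeff_coe,
    coeff_reverse, revAt_le (by omega), show f'.natDegree - (f'.natDegree - i) = i by omega,
    ← dualDot_pow_comp_d]
  exact Linear.smul_comp _ _ _ _ _ _

section

variable (hκ : κ = (f'.natDegree : ℤ) - (f.natDegree : ℤ))
include hκ

/-- The `j` additional dots reach every degree above deg f'; the left side lies in any left tensor
ideal containing f(x). -/
theorem ccwBubble_polyUp (j : ℕ) : c k κ ≫ downObj k κ ◁ polyUp κ f ≫
    (dotDownUp k κ ^ j : End (downObj k κ ⊗ upObj k κ)) ≫ d' k κ =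
      coeffHom (f'.natDegree + (j + 1))
        (ccwSeries k κ * extendScalars κ (f.reverse : PowerSeries k)) := by
  rw [coeffHom_mul_extendScalars]
  simp only [Polynomial.coeff_coe]
  refine Eq.trans ?_ (sum_coeff_smul_eq_sum_coeff_reverse_smul f f'.natDegree (j + 1)
    (M := 𝟙_ (Heis k κ) ⟶ 𝟙_ (Heis k κ)) (g := fun i => ccwNat k κ (i + j))
        (T := fun r => coeffHom r (ccwSeries k κ)) hκ
    (fun i m h => ?_) fun i h => ?_)
  · rw [whiskerLeft_polyUp, Preadditive.sum_comp, Preadditive.comp_sum]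
    refine Finset.sum_congr rfl fun i _ => ?_
    rw [ccwNat_eq, add_comm i, pow_add, End.mul_def, Category.assoc]
    exact (congrArg _ (Linear.smul_comp _ _ _ _ _ _)).trans (Linear.comp_smul _ _ _ _ _ _)
  · exact (coeffHom_ccwSeries k κ m (i + j) (by push_cast at h ⊢; omega)).symm
  · exact ccwNat_eq_zero k κ _ (by push_cast at h ⊢; omega)

theorem cwBubble_polyDown (j : ℕ) : -(c' k κ ≫ upObj k κ ◁ polyDown κ f' ≫
    (dotUpDown k κ ^ j : End (upObj k κ ⊗ downObj k κ)) ≫ d k κ) =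
      coeffHom (f.natDegree + (j + 1))
        (cwSeries k κ * extendScalars κ (f'.reverse : PowerSeries k)) := by
  rw [coeffHom_mul_extendScalars]
  simp only [Polynomial.coeff_coe]
  refine Eq.trans ?_ (sum_coeff_smul_eq_sum_coeff_reverse_smul f' f.natDegree (j + 1)
    (M := 𝟙_ (Heis k κ) ⟶ 𝟙_ (Heis k κ)) (g := fun i => -cwNat k κ (i + j))
        (T := fun r => coeffHom r (cwSeries k κ))
    (κ := -κ) (by omega) (fun i m h => ?_) fun i h => ?_)
  · rw [whiskerLeft_polyDown, Preadditive.sum_comp, Preadditive.comp_sum, ← Finset.sum_neg_distrib]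
    refine Finset.sum_congr rfl fun i _ => ?_
    rw [cwNat_eq, ← dualDot_pow_comp_d, ← dualDot_pow_comp_d, add_comm i, pow_add, End.mul_def,
      Category.assoc, smul_neg]
    exact congrArg Neg.neg
      ((congrArg _ (Linear.smul_comp _ _ _ _ _ _)).trans (Linear.comp_smul _ _ _ _ _ _))
  · exact (coeffHom_cwSeries k κ m (i + j) (by push_cast at h ⊢; omega)).symm
  · rw [cwNat_eq_zero k κ _ (by push_cast at h ⊢; omega), neg_zero]

/-- Summing the curl relation over the coefficients of `f` is multiplication of the bubble series by
the reversed polynomial; powers below `-κ` contribute nothing. -/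
theorem downCurl_polyUp : t k κ ≫ downObj k κ ◁ polyUp κ f ≫ d' k κ =
    ∑ p ∈ antidiagonal f'.natDegree,
      ((dotUpDown k κ ^ p.1 : End (upObj k κ ⊗ downObj k κ)) ≫ d k κ) ≫
        coeffHom p.2 (ccwSeries k κ * extendScalars κ (f.reverse : PowerSeries k)) := by
  have h := sum_coeff_smul_eq_sum_coeff_reverse_smul f f'.natDegree 0
    (g := fun i => t k κ ≫ (dotDownUp k κ ^ i : End (downObj k κ ⊗ upObj k κ)) ≫ d' k κ)
    (T := fun m => ∑ p ∈ antidiagonal m,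
      ((dotUpDown k κ ^ p.1 : End (upObj k κ ⊗ downObj k κ)) ≫ d k κ) ≫
        coeffHom p.2 (ccwSeries k κ)) hκ
    (fun i m h => downCurl k κ i m (by omega)) fun i h => downCurl_of_neg k κ i (by omega)
  refine Eq.trans ?_ (h.trans ?_)
  · rw [whiskerLeft_polyUp, Preadditive.sum_comp, Preadditive.comp_sum]
    refine Finset.sum_congr rfl fun i _ => ?_
    exact (congrArg _ (Linear.smul_comp _ _ _ _ _ _)).trans (Linear.comp_smul _ _ _ _ _ _)
  · simp only [Finset.smul_sum, coeffHom_mul_extendScalars, Preadditive.comp_sum, add_zero,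
      Linear.comp_smul, Polynomial.coeff_coe]
    exact Finset.Nat.sum_antidiagonal_sum_antidiagonal_comm (fun a b c => f.reverse.coeff a •
      (((dotUpDown k κ ^ b : End (upObj k κ ⊗ downObj k κ)) ≫ d k κ) ≫
        coeffHom c (ccwSeries k κ))) _

theorem upCurl_polyDown : c' k κ ≫ upObj k κ ◁ polyDown κ f' ≫ t k κ =
    ∑ p ∈ antidiagonal f.natDegree,
      coeffHom p.2 (cwSeries k κ * extendScalars κ (f'.reverse : PowerSeries k)) ≫
        c k κ ≫ (dotDownUp k κ ^ p.1 : End (downObj k κ ⊗ upObj k κ)) := by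
  have h := sum_coeff_smul_eq_sum_coeff_reverse_smul f' f.natDegree 0
    (g := fun i => c' k κ ≫ (dualDotUpDown k κ ^ i : End (upObj k κ ⊗ downObj k κ)) ≫ t k κ)
    (T := fun m => ∑ p ∈ antidiagonal m, coeffHom p.2 (cwSeries k κ) ≫
      c k κ ≫ (dotDownUp k κ ^ p.1 : End (downObj k κ ⊗ upObj k κ))) (κ := -κ) (by omega)
    (fun i m h => upCurl k κ i m (by omega)) fun i h => upCurl_of_neg k κ i (by omega)
  refine Eq.trans ?_ (h.trans ?_)
  · rw [whiskerLeft_polyDown, Preadditive.sum_comp, Preadditive.comp_sum]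
    refine Finset.sum_congr rfl fun i _ => ?_
    exact (congrArg _ (Linear.smul_comp _ _ _ _ _ _)).trans (Linear.comp_smul _ _ _ _ _ _)
  · simp only [Finset.smul_sum, coeffHom_mul_extendScalars, Preadditive.sum_comp, add_zero,
      Linear.smul_comp, Polynomial.coeff_coe]
    exact Finset.Nat.sum_antidiagonal_sum_antidiagonal_comm (fun a b e => f'.reverse.coeff a •
      (coeffHom e (cwSeries k κ) ≫
        c k κ ≫ (dotDownUp k κ ^ b : End (downObj k κ ⊗ upObj k κ)))) _

variable (hf : f.Monic) (hf' : f'.Monic) {I : LeftTensorIdeal k (Heis k κ)}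
include hf hf'

theorem ccwRel_mem (hI : polyUp κ f ∈ I.hom _ _)
    (hb : ∀ r, 1 ≤ r → r ≤ f'.natDegree → ccwRel κ f f' r ∈ I.hom (𝟙_ _) (𝟙_ _)) (r : ℕ) :
    ccwRel κ f f' r ∈ I.hom (𝟙_ _) (𝟙_ _) := by
  rw [ccwRel_mem_iff]
  refine PowerSeries.coeff_mem_of_coeff_mul_mem
    (F := extendScalars κ (f.reverse : PowerSeries k)) ?_ f'.natDegree (fun i hi => ?_)
    (fun i hi => ?_) r
  · rw [PowerSeries.coeff_map, reverse_coeff_zero hf, map_one]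
  · rcases Nat.eq_zero_or_pos i with rfl | h0
    -- Degree 0 is not among the generators: the bubble and the scalar are both 1.
    · rw [map_sub, coeff_zero_ccwSeries, PowerSeries.coeff_map]
      have : PowerSeries.coeff 0 (deltaSeries f f') = 1 := by
        have h := congrArg (PowerSeries.coeff 0) (deltaSeries_mul (f' := f') hf)
        rwa [PowerSeries.coeff_mul, Finset.Nat.antidiagonal_zero, Finset.sum_singleton,
          reverse_coeff_zero hf, reverse_coeff_zero hf', mul_one] at h
      rw [this, map_one, sub_self]
      exact Ideal.zero_mem _
    · exact (ccwRel_mem_iff I i).mp (hb i h0 hi)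
  · obtain ⟨j, rfl⟩ : ∃ j, i = f'.natDegree + (j + 1) := ⟨i - f'.natDegree - 1, by omega⟩
    have h0 : PowerSeries.coeff (f'.natDegree + (j + 1)) (f'.reverse : PowerSeries k) = 0 := by
      rw [Polynomial.coeff_coe]
      exact coeff_eq_zero_of_natDegree_lt (lt_of_le_of_lt (reverse_natDegree_le f') (by omega))
    -- After multiplication by the reversal of `f` the scalar part is the reversal of `f'`, which
    -- has no coefficient in this degree.
    rw [sub_mul, ← map_mul, deltaSeries_mul hf, map_sub, PowerSeries.coeff_map, h0, map_zero,
      sub_zero]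
    have h := ccwBubble_polyUp hκ j
    rw [LeftTensorIdeal.mem_unitIdeal]
    refine (Eq.subst (motive := fun m => m ∈ I.hom (𝟙_ _) (𝟙_ _)) h ?_ :)
    exact I.precomp_mem _ (I.postcomp_mem _ (I.whiskerLeft_mem _ hI))

theorem cwRel_mem (hI : polyDown κ f' ∈ I.hom _ _)
    (hb : ∀ r, 1 ≤ r → r ≤ f.natDegree → cwRel κ f f' r ∈ I.hom (𝟙_ _) (𝟙_ _)) (r : ℕ) :
    cwRel κ f f' r ∈ I.hom (𝟙_ _) (𝟙_ _) := by
  rw [cwRel_mem_iff]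
  refine PowerSeries.coeff_mem_of_coeff_mul_mem
    (F := extendScalars κ (f'.reverse : PowerSeries k)) ?_ f.natDegree (fun i hi => ?_)
    (fun i hi => ?_) r
  · rw [PowerSeries.coeff_map, reverse_coeff_zero hf', map_one]
  · rcases Nat.eq_zero_or_pos i with rfl | h0
    · rw [map_sub, coeff_zero_cwSeries, PowerSeries.coeff_map]
      have : PowerSeries.coeff 0 (-deltaSeries' f f') = 1 := by
        have h := congrArg (PowerSeries.coeff 0) (deltaSeries'_mul (f := f) hf')
        rwa [PowerSeries.coeff_mul, Finset.Nat.antidiagonal_zero, Finset.sum_singleton,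
          reverse_coeff_zero hf, reverse_coeff_zero hf', mul_one] at h
      rw [this, map_one, sub_self]
      exact Ideal.zero_mem _
    · exact (cwRel_mem_iff I i).mp (hb i h0 hi)
  · obtain ⟨j, rfl⟩ : ∃ j, i = f.natDegree + (j + 1) := ⟨i - f.natDegree - 1, by omega⟩
    have h0 : PowerSeries.coeff (f.natDegree + (j + 1)) (f.reverse : PowerSeries k) = 0 := by
      rw [Polynomial.coeff_coe]
      exact coeff_eq_zero_of_natDegree_lt (lt_of_le_of_lt (reverse_natDegree_le f) (by omega))
    rw [sub_mul, ← map_mul, deltaSeries'_mul hf', map_sub, PowerSeries.coeff_map, h0, map_zero,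
      sub_zero]
    have h := cwBubble_polyDown hκ j
    rw [LeftTensorIdeal.mem_unitIdeal]
    refine (Eq.subst (motive := fun m => m ∈ I.hom (𝟙_ _) (𝟙_ _)) h ?_ :)
    exact neg_mem (I.precomp_mem _ (I.postcomp_mem _ (I.whiskerLeft_mem _ hI)))

-- The curl carrying f(x) is in the ideal and is congruent to the cap carrying f'(x'), because the
-- bubble series times the reversal of `f` is congruent to the reversal of `f'`. Rotating the cap
-- back tensors the ideal element on the left only, as a left tensor ideal permits.
omit hf' in
theorem polyDown_mem (hI : polyUp κ f ∈ I.hom _ _)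
    (hb : ∀ r, ccwRel κ f f' r ∈ I.hom (𝟙_ _) (𝟙_ _)) : polyDown κ f' ∈ I.hom _ _ := by
  have h1 : upObj k κ ◁ polyDown κ f' ≫ d k κ ∈ I.hom _ _ := by
    have h2 : t k κ ≫ downObj k κ ◁ polyUp κ f ≫ d' k κ ∈ I.hom _ _ :=
      I.precomp_mem _ (I.postcomp_mem _ (I.whiskerLeft_mem _ hI))
    rw [← Submodule.sub_mem_iff_left _ h2, ← neg_mem_iff, neg_sub, polyDown_comp_d,
        downCurl_polyUp hκ,
      ← Finset.sum_sub_distrib]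
    refine sum_mem fun p _ => ?_
    rw [← Preadditive.comp_sub]
    refine I.precomp_mem _ ?_
    have h3 := PowerSeries.coeff_mul_mem (fun i => (ccwRel_mem_iff I i).mp (hb i))
      (extendScalars κ (f.reverse : PowerSeries k)) p.2
    rw [mul_comm, sub_mul, ← map_mul, deltaSeries_mul hf, map_sub] at h3
    exact h3
  have h4 := mate_whiskerLeft_comp_evaluation (U := upObj k κ) (polyDown κ f')
  rw [← h4, mate_def]
  exact I.precomp_mem _ (I.precomp_mem _ (I.precomp_mem _
    (I.postcomp_mem _ (I.whiskerLeft_mem _ h1))))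

-- The mirror image: the curl is formed with `c'` and `t`, the clockwise series is multiplied by the
-- reversal of `f'`, and a cup is rotated, again by tensoring on the left only.
omit hf in
theorem polyUp_mem (hI : polyDown κ f' ∈ I.hom _ _)
    (hb : ∀ r, cwRel κ f f' r ∈ I.hom (𝟙_ _) (𝟙_ _)) : polyUp κ f ∈ I.hom _ _ := by
  have h1 : c k κ ≫ downObj k κ ◁ polyUp κ f ∈ I.hom _ _ := by
    have h2 : c' k κ ≫ upObj k κ ◁ polyDown κ f' ≫ t k κ ∈ I.hom _ _ :=
      I.precomp_mem _ (I.postcomp_mem _ (I.whiskerLeft_mem _ hI))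
    rw [← Submodule.sub_mem_iff_left _ h2, ← neg_mem_iff, neg_sub, c_comp_polyUp,
        upCurl_polyDown hκ,
      ← Finset.sum_sub_distrib]
    refine sum_mem fun p _ => ?_
    rw [← Preadditive.sub_comp]
    refine I.postcomp_mem _ ?_
    have h3 := PowerSeries.coeff_mul_mem (fun i => (cwRel_mem_iff I i).mp (hb i))
      (extendScalars κ (f'.reverse : PowerSeries k)) p.2
    rw [mul_comm, sub_mul, ← map_mul, deltaSeries'_mul hf', map_sub] at h3
    exact h3
  have h4 := comate_coevaluation_comp_whiskerLeft (U := upObj k κ) (polyUp κ f)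
  rw [← h4, comate_def]
  exact I.precomp_mem _ (I.postcomp_mem _ (I.whiskerLeft_mem _ h1))

end

end Heisenberg

/-! ### Equality of the two ideals. -/

theorem lemma1p6 {k : Type u} [CommRing k] (f f' : k[X]) (hf : f.Monic) (hf' : f'.Monic)
    (κ : ℤ) (hκ : κ = (f'.natDegree : ℤ) - (f.natDegree : ℤ)) :
    Heisenberg.cyclotomicIdeal κ f f' =
        LeftTensorIdeal.span k (Heisenberg.IsGenDown κ f f') ∧
      (∀ r : ℕ, Heisenberg.ccwRel κ f f' r ∈
        (Heisenberg.cyclotomicIdeal κ f f').hom (𝟙_ _) (𝟙_ _)) ∧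
      (∀ r : ℕ, Heisenberg.cwRel κ f f' r ∈
        (Heisenberg.cyclotomicIdeal κ f f').hom (𝟙_ _) (𝟙_ _)) := by
  have hp : Heisenberg.polyUp κ f ∈ (Heisenberg.cyclotomicIdeal κ f f').hom _ _ :=
    LeftTensorIdeal.subset_span _ .poly
  have hccw : ∀ r, Heisenberg.ccwRel κ f f' r ∈
      (Heisenberg.cyclotomicIdeal κ f f').hom (𝟙_ _) (𝟙_ _) :=
    Heisenberg.ccwRel_mem hκ hf hf' hp fun r h₁ h₂ =>
      LeftTensorIdeal.subset_span _ (.bubble r h₁ h₂)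
  have hcw := Heisenberg.cwRel_mem_of_ccwRel_mem hf hf' hccw
  have hp' : Heisenberg.polyDown κ f' ∈
      (LeftTensorIdeal.span k (Heisenberg.IsGenDown κ f f')).hom _ _ :=
    LeftTensorIdeal.subset_span _ .poly
  have hcw' : ∀ r, Heisenberg.cwRel κ f f' r ∈
      (LeftTensorIdeal.span k (Heisenberg.IsGenDown κ f f')).hom (𝟙_ _) (𝟙_ _) :=
    Heisenberg.cwRel_mem hκ hf hf' hp' fun r h₁ h₂ =>
      LeftTensorIdeal.subset_span _ (.bubble r h₁ h₂)
  refine ⟨LeftTensorIdeal.ext (funext fun X => funext fun Y => le_antisymm ?_ ?_), hccw, hcw⟩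
  · refine LeftTensorIdeal.span_le (fun _ _ g hg => ?_) X Y
    cases hg with
    | poly => exact Heisenberg.polyUp_mem hκ hf' hp' hcw'
    | bubble r _ _ => exact Heisenberg.ccwRel_mem_of_cwRel_mem hf hf' hcw' r
  · refine LeftTensorIdeal.span_le (fun _ _ g hg => ?_) X Y
    cases hg with
    | poly => exact Heisenberg.polyDown_mem hκ hf hp hccw
    | bubble r _ _ => exact hcw r
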